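/- **Theorem 3.** Words are (finite or infinite) sequences of nonnegative integers, $\overline{w}=www\cdots$, and $x\prec y$ (alternate order) means that at the first index $k\ge 1$ at which $x$ and $y$ differ one has $(-1)^k(x_k-y_k)<0$; $x\preceq y$ means $x\prec y$ or $x=y$. An infinite word $x$ is an alternate Lyndon word if $x\preceq (x_i)_{i\ge n}$ for all $n\ge 1$. Let $\phi^\infty(1)=100111001\cdots$ be the limit of the words $\phi^n(1)$, where $\phi$ is the morphism $\phi(0)=1$, $\phi(1)=100$. For $\beta>1$ put $l_\beta=-\frac{\beta}{\beta+1}$ and $T_{-\beta}(x)=-\beta x-\lfloor -\beta x-l_\beta\rfloor$; the $(-\beta)$-expansion of $x\in[l_\beta,l_\beta+1)$ is the sequence $x_i=\lfloor -\beta T_{-\beta}^{i-1}(x)-l_\beta\rfloor$, $i\ge 1$. Let $\mathbf{Lyn}$ be the set of alternate Lyndon words $d$ for which there is a periodic alternate Lyndon word $a=\overline{a_1\cdots a_k}$, with $k$ minimal and $a_k\neq 0$, such that $d\neq a$ and $$\mathrm{min}_k\preceq d\preceq \mathrm{max}_k\prec\phi^\infty(1),$$ where, if $k$ is even, $\mathrm{min}_k=a_1\cdots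 a_{k-1}(a_k-1)0\,\overline{a_1\cdots a_k}$ and $\mathrm{max}_k=\overline{a_1\cdots a_k}$, and, if $k$ is odd, $\mathrm{min}_k=a_1\cdots a_k\,\overline{a_1\cdots a_{k-1}(a_k-1)0}$ and $\mathrm{max}_k=\overline{a_1\cdots a_{k-1}(a_k-1)0}$. For an infinite word $d$ let $d^*=\overline{d_1\cdots d_{2p}(d_{2p+1}-1)0}$ if $d=\overline{d_1\cdots d_{2p+1}}$ with $2p+1$ its minimal period and $d_{2p+1}\ne 0$, and $d^*=d$ otherwise. A sequence $d=(d_i)_{i\ge 1}$ of nonnegative integers is the $(-\beta)$-expansion of $-\frac{\beta}{\beta+1}$ for some real $\beta>1$ if and only if the following three conditions hold: (a) for all $n\ge 1$, $(d_i)_{i\ge 1}\preceq(d_i)_{i\ge n}\prec 0\,d^*_1d^*_2\cdots$; (b) $d\notin\mathbf{Lyn}$; (c) $d\prec\phi^\infty(1)$. -/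

import Mathlib

/-! Infinite words over the nonnegative integers are functions `ℕ → ℕ`; the word
`x₁ x₂ x₃ ⋯` is the function with `x 0 = x₁`, `x 1 = x₂`, and so on. -/

namespace NegBeta

/-- Strict alternate order: at the first index `k` (counted from `1`) where the words differ,
`(-1)^k (x_k - y_k) < 0`. Positions are counted from `0` here, whence the exponent `k + 1`. -/
def AltLT (x y : ℕ → ℕ) : Prop :=
  ∃ k : ℕ, (∀ i < k, x i = y i) ∧ (-1 : ℤ) ^ (k + 1) * ((x k : ℤ) - (y k : ℤ)) < 0

/-- Alternate order. -/
def AltLE (x y : ℕ → ℕ) : Prop := x = y ∨ AltLT x y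

/-- The word `x` with its first `n` letters removed. -/
def shift (n : ℕ) (x : ℕ → ℕ) : ℕ → ℕ := fun i => x (i + n)

/-- Concatenation of a finite word and an infinite word. -/
def concat (w : List ℕ) (x : ℕ → ℕ) : ℕ → ℕ :=
  fun i => if i < w.length then w.getD i 0 else x (i - w.length)

/-- The infinite word `w w w ⋯`, for a nonempty finite word `w`. -/
def rep (w : List ℕ) : ℕ → ℕ := fun i => w.getD (i % w.length) 0

/-- The prefix `x₁ ⋯ x_n`. -/
def pre (x : ℕ → ℕ) (n : ℕ) : List ℕ := (List.range n).map x

/-- The finite word `a₁ ⋯ a_{k-1} (a_k - 1) 0`; used only for `1 ≤ k` and `a_k ≠ 0`. -/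
def lowered (a : ℕ → ℕ) (k : ℕ) : List ℕ := pre a (k - 1) ++ [a (k - 1) - 1, 0]

/-- Alternate Lyndon words. -/
def IsAltLyndon (x : ℕ → ℕ) : Prop := ∀ n : ℕ, AltLE x (shift n x)

/-- `x` is the periodic word with repeated block `x₁ ⋯ x_k`, and `k ≥ 1` is minimal. -/
def HasMinPeriod (x : ℕ → ℕ) (k : ℕ) : Prop :=
  IsLeast {m : ℕ | 0 < m ∧ Function.Periodic x m} k

/-- The morphism `0 ↦ 1`, `1 ↦ 100` on letters. -/
def phiLetter : Fin 2 → List (Fin 2)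
  | 0 => [1]
  | 1 => [1, 0, 0]

/-- The morphism on finite words. -/
def phi (w : List (Fin 2)) : List (Fin 2) := w.flatMap phiLetter

/-- The limit `φ^∞(1)` of the words `φⁿ(1)`, each of which is a proper prefix of the next. -/
def phiInf : ℕ → ℕ := fun i => (((phi^[i] [1]).getD i 0 : Fin 2) : ℕ)

/-- `min_k`, for the periodic word `a` of minimal period `k`. -/
def minWord (a : ℕ → ℕ) (k : ℕ) : ℕ → ℕ :=
  if Even k then concat (lowered a k) a else concat (pre a k) (rep (lowered a k))

/-- `max_k`, for the periodic word `a` of minimal period `k`. -/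
def maxWord (a : ℕ → ℕ) (k : ℕ) : ℕ → ℕ :=
  if Even k then a else rep (lowered a k)

/-- The exceptional set of alternate Lyndon words. -/
def Lyn : Set (ℕ → ℕ) :=
  {d | IsAltLyndon d ∧ ∃ (a : ℕ → ℕ) (k : ℕ),
    IsAltLyndon a ∧ HasMinPeriod a k ∧ a (k - 1) ≠ 0 ∧ d ≠ a ∧
    AltLE (minWord a k) d ∧ AltLE d (maxWord a k) ∧ AltLT (maxWord a k) phiInf}

open Classical in
/-- The word `d*`: if `d` is periodic with odd minimal period `k` (and `d_k ≠ 0`, so that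
`d_k - 1` is a letter), it is the periodic word with block `d₁ ⋯ d_{k-1} (d_k - 1) 0`;
otherwise it is `d`. -/
noncomputable def dStar (d : ℕ → ℕ) : ℕ → ℕ :=
  if h : ∃ k : ℕ, HasMinPeriod d k ∧ Odd k ∧ d (k - 1) ≠ 0 then rep (lowered d h.choose) else d

/-- The left end point `l_β = -β/(β+1)`. -/
noncomputable def leftEnd (β : ℝ) : ℝ := -β / (β + 1)

/-- The `(-β)`-transformation (a self-map of `[l_β, l_β + 1)`). -/
noncomputable def T (β x : ℝ) : ℝ := -β * x - (⌊-β * x - leftEnd β⌋ : ℝ)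

/-- The digits of the `(-β)`-expansion of `x ∈ [l_β, l_β + 1)`; `negDigit β x i` is the
digit number `i + 1`. -/
noncomputable def negDigit (β x : ℝ) (i : ℕ) : ℤ := ⌊-β * (T β)^[i] x - leftEnd β⌋

/-- The word `d` is the `(-β)`-expansion of `x ∈ [l_β, l_β + 1)`. -/
def IsNegExpansion (β x : ℝ) (d : ℕ → ℕ) : Prop := ∀ i : ℕ, (d i : ℤ) = negDigit β x i

end NegBeta

/-! Let `val s x` be the number written by the word `x` in base `-s`, measured from the left end
point. By `isNegExpansion_iff`, `d` expands the left end point in base `-β` exactly when it is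
bounded, has value `0`, and all its tails have values in `[0, 1)`.

Necessity. On words with such tails the value is strictly increasing for the alternate order, so `d`
is a Lyndon word. A letter `0` before a tail of value `0` would produce the excluded value `1`; this
gives the upper bound in (a). For (c), a binary Lyndon word that is at least `φ^∞(1)` is the image
under `φ` of another one. Desubstituting repeatedly turns the value into functions of the same shape
whose weights grow without limit, and none of these can vanish on a bounded set of values
(`lt_phiInf_of_val_eq_zero`). For (b), a word of `Lyn` is a concatenation of the blocks `A = a₁⋯a_k`
and `B = a₁⋯(a_k - 1)0`, and `Ad`, `Bd` have the same value `c`. If `c = 0`, every coded tail has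
value `0`, so `B`, which ends in `0`, never occurs and `d = a`. If `c ≠ 0`, then `1 ≤ β^(-k) +
β^(-k-1)`; this makes `d` binary, and then the blocks can be desubstituted to shorter ones forever
(`not_binaryCode`).

Sufficiency. For a Lyndon word `d` below `φ^∞(1)`, count the words of length `n` all of whose
suffixes are at least the corresponding prefix of `d`. The counts are submultiplicative with growth
rate `β > 1`, and their generating functions express `val s` for `s > β`. As `s` decreases to `β`
the denominator blows up, which leaves `val β d = 0` and all tails with values in `[0, 1]`
(`exists_base`). Finally `d` is compared with the true expansion `a`: they can separate only where
`a` returns to value `0` and the other word sits at value `1`. There a block `A` is replaced by `B`,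
so `d ≠ a` forces `d ∈ Lyn` (`isNegExpansion_or_mem_lyn`). -/

namespace NegBeta

/-! ### The alternate order -/

theorem shift_shift (m n : ℕ) (x : ℕ → ℕ) : shift m (shift n x) = shift (m + n) x := by
  funext i; simp [shift, add_assoc]

@[simp] theorem shift_zero (x : ℕ → ℕ) : shift 0 x = x := rfl

theorem word_ext {x y : ℕ → ℕ} (h0 : x 0 = y 0) (h1 : shift 1 x = shift 1 y) : x = y := by
  funext i
  cases i with
  | zero => exact h0
  | succ i => exact congrFun h1 i

theorem altLT_iff {x y : ℕ → ℕ} :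
    AltLT x y ↔ y 0 < x 0 ∨ (x 0 = y 0 ∧ AltLT (shift 1 y) (shift 1 x)) := by
  constructor
  · rintro ⟨k, h, hk⟩
    cases k with
    | zero => left; simp at hk; omega
    | succ k =>
      right
      refine ⟨h 0 (Nat.succ_pos k), k, fun i hi => (h (i + 1) (by omega)).symm, ?_⟩
      simp only [shift]
      rw [pow_succ] at hk
      linarith
  · rintro (h | ⟨h0, k, h, hk⟩)
    · refine ⟨0, by simp, ?_⟩
      simp; omega
    · refine ⟨k + 1, ?_, ?_⟩
      · intro i hi
        cases i with
        | zero => exact h0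
        | succ i => exact (h i (by omega)).symm
      · simp only [shift] at hk
        rw [pow_succ]
        linarith

/-- Dropping a common first letter reverses the order, so the induction step exchanges the two
words. Claims proved this way must therefore be stated in both directions. -/
theorem AltLT.induct {P : (ℕ → ℕ) → (ℕ → ℕ) → Prop}
    (h0 : ∀ x y, y 0 < x 0 → P x y)
    (h1 : ∀ x y, x 0 = y 0 → AltLT (shift 1 y) (shift 1 x) → P (shift 1 y) (shift 1 x) → P x y)
    {x y : ℕ → ℕ} (h : AltLT x y) : P x y := by
  obtain ⟨k, h, hk⟩ := h
  induction k generalizing x y with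
  | zero => exact h0 x y (by simp at hk; omega)
  | succ k ih =>
    have h' : ∀ i < k, shift 1 y i = shift 1 x i := fun i hi => (h (i + 1) (by omega)).symm
    have hk' : (-1 : ℤ) ^ (k + 1) * ((shift 1 y k : ℤ) - (shift 1 x k : ℤ)) < 0 := by
      simp only [shift]
      rw [pow_succ] at hk
      linarith
    exact h1 x y (h 0 (Nat.succ_pos k)) ⟨k, h', hk'⟩ (ih h' hk')

theorem altLT_irrefl (x : ℕ → ℕ) : ¬ AltLT x x := by
  rintro ⟨k, -, hk⟩
  simp at hk

theorem AltLT.trans {x y z : ℕ → ℕ} (h : AltLT x y) (h' : AltLT y z) : AltLT x z := by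
  have key : (∀ z, AltLT y z → AltLT x z) ∧ (∀ z, AltLT z x → AltLT z y) := by
    refine AltLT.induct (P := fun x y => (∀ z, AltLT y z → AltLT x z) ∧ (∀ z, AltLT z x → AltLT z y))
      ?_ ?_ h
    · intro x y hxy
      constructor
      · intro z hz
        rw [altLT_iff] at hz ⊢
        rcases hz with hz | ⟨hz, -⟩ <;> left <;> omega
      · intro z hz
        rw [altLT_iff] at hz ⊢
        rcases hz with hz | ⟨hz, -⟩ <;> left <;> omega
    · rintro x y hxy - ⟨ih1, ih2⟩
      constructor
      · intro z hz
        rw [altLT_iff] at hz ⊢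
        rcases hz with hz | ⟨hz, hz'⟩
        · left; omega
        · exact Or.inr ⟨by omega, ih2 _ hz'⟩
      · intro z hz
        rw [altLT_iff] at hz ⊢
        rcases hz with hz | ⟨hz, hz'⟩
        · left; omega
        · exact Or.inr ⟨by omega, ih1 _ hz'⟩
  exact key.1 z h'

theorem altLT_trichotomy (x y : ℕ → ℕ) : AltLT x y ∨ x = y ∨ AltLT y x := by
  by_cases hxy : x = y
  · exact Or.inr (Or.inl hxy)
  · have hex : ∃ k, x k ≠ y k := by
      by_contra! hcon
      exact hxy (funext hcon)
    classical
    have hk := Nat.find_spec hex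
    have hlt : ∀ i < Nat.find hex, x i = y i := fun i hi => by
      by_contra hcon
      exact Nat.find_min hex hi hcon
    set k := Nat.find hex
    have hne : ((x k : ℤ) - y k) ≠ 0 := by
      intro h0
      apply hk
      omega
    have hne' : (-1 : ℤ) ^ (k + 1) * ((x k : ℤ) - y k) ≠ 0 :=
      mul_ne_zero (pow_ne_zero _ (by norm_num)) hne
    rcases lt_or_gt_of_ne hne' with h | h
    · exact Or.inl ⟨k, hlt, h⟩
    · refine Or.inr (Or.inr ⟨k, fun i hi => (hlt i hi).symm, ?_⟩)
      linarith

theorem AltLT.le {x y : ℕ → ℕ} (h : AltLT x y) : AltLE x y := Or.inr h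

theorem AltLE.trans_lt {x y z : ℕ → ℕ} (h : AltLE x y) (h' : AltLT y z) : AltLT x z := by
  rcases h with rfl | h
  · exact h'
  · exact h.trans h'

theorem AltLT.trans_le {x y z : ℕ → ℕ} (h : AltLT x y) (h' : AltLE y z) : AltLT x z := by
  rcases h' with rfl | h'
  · exact h
  · exact h.trans h'

theorem AltLE.trans {x y z : ℕ → ℕ} (h : AltLE x y) (h' : AltLE y z) : AltLE x z := by
  rcases h with rfl | h
  · exact h'
  · exact (h.trans_le h').le

theorem not_altLT {x y : ℕ → ℕ} : ¬ AltLT x y ↔ AltLE y x := by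
  constructor
  · intro h
    rcases altLT_trichotomy x y with h' | h' | h'
    · exact absurd h' h
    · exact Or.inl h'.symm
    · exact Or.inr h'
  · intro h h'
    exact altLT_irrefl _ (h.trans_lt h')

theorem AltLE.antisymm {x y : ℕ → ℕ} (h : AltLE x y) (h' : AltLE y x) : x = y := by
  rcases h with rfl | h
  · rfl
  · exact absurd h (not_altLT.2 h')

theorem altLE_iff {x y : ℕ → ℕ} :
    AltLE x y ↔ y 0 < x 0 ∨ (x 0 = y 0 ∧ AltLE (shift 1 y) (shift 1 x)) := by
  rw [← not_altLT, altLT_iff, ← not_altLT]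
  constructor
  · intro h
    push Not at h
    obtain ⟨h1, h2⟩ := h
    rcases h1.lt_or_eq with h3 | h3
    · exact Or.inl h3
    · exact Or.inr ⟨h3.symm, h2 h3⟩
  · rintro (h | ⟨h1, h2⟩) (h' | ⟨h1', h2'⟩)
    · omega
    · omega
    · omega
    · exact h2 h2'

theorem AltLE.head_le {x y : ℕ → ℕ} (h : AltLE x y) : y 0 ≤ x 0 := by
  rcases altLE_iff.1 h with h | ⟨h, -⟩ <;> omega

theorem AltLE.tail {x y : ℕ → ℕ} (h : AltLE x y) (h0 : x 0 = y 0) :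
    AltLE (shift 1 y) (shift 1 x) := by
  rcases altLE_iff.1 h with h | ⟨-, h⟩
  · omega
  · exact h

/-! ### Concatenation -/

@[simp] theorem concat_nil (x : ℕ → ℕ) : concat [] x = x := by
  funext i; simp [concat]

@[simp] theorem concat_cons_zero (j : ℕ) (w : List ℕ) (x : ℕ → ℕ) : concat (j :: w) x 0 = j := by
  simp [concat]

@[simp] theorem shift_one_concat_cons (j : ℕ) (w : List ℕ) (x : ℕ → ℕ) :
    shift 1 (concat (j :: w) x) = concat w x := by
  funext i; simp [concat, shift]

theorem concat_append (w w' : List ℕ) (x : ℕ → ℕ) :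
    concat (w ++ w') x = concat w (concat w' x) := by
  induction w with
  | nil => simp
  | cons j w ih => exact word_ext (by simp) (by simpa using ih)

theorem shift_length_concat (w : List ℕ) (x : ℕ → ℕ) : shift w.length (concat w x) = x := by
  funext i; simp [concat, shift]

theorem concat_pre_shift (x : ℕ → ℕ) (n : ℕ) : concat (pre x n) (shift n x) = x := by
  funext i
  by_cases h : i < n
  · simp [concat, pre, h, List.getD]
  · simp only [concat, pre, shift, List.length_map, List.length_range, h, if_false]
    congr 1; omega

@[simp] theorem length_pre (x : ℕ → ℕ) (n : ℕ) : (pre x n).length = n := by simp [pre]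

theorem pre_succ (x : ℕ → ℕ) (n : ℕ) : pre x (n + 1) = pre x n ++ [x n] := by
  simp [pre, List.range_succ]

theorem pre_concat_length (w : List ℕ) (x : ℕ → ℕ) : pre (concat w x) w.length = w := by
  apply List.ext_getElem
  · simp
  · intro i h1 h2
    simp [pre, concat, h2, List.getD]

theorem concat_lt_concat (w : List ℕ) (x y : ℕ → ℕ) :
    (Even w.length → (AltLT (concat w x) (concat w y) ↔ AltLT x y)) ∧
    (Odd w.length → (AltLT (concat w x) (concat w y) ↔ AltLT y x)) := by
  induction w generalizing x y with
  | nil => simp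
  | cons j w ih =>
    rw [altLT_iff]
    simp only [List.length_cons, concat_cons_zero, lt_irrefl, true_and, false_or,
      shift_one_concat_cons]
    refine ⟨fun h => (ih y x).2 ?_, fun h => (ih y x).1 ?_⟩
    · rcases Nat.even_or_odd w.length with h' | h'
      · exact absurd h (by simpa [Nat.even_add_one] using h')
      · exact h'
    · rcases Nat.even_or_odd w.length with h' | h'
      · exact h'
      · exact absurd h (by simpa [Nat.odd_add_one] using h')

theorem concat_le_concat (w : List ℕ) (x y : ℕ → ℕ) :
    (Even w.length → (AltLE (concat w x) (concat w y) ↔ AltLE x y)) ∧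
    (Odd w.length → (AltLE (concat w x) (concat w y) ↔ AltLE y x)) := by
  simp only [← not_altLT]
  exact ⟨fun h => not_congr ((concat_lt_concat w y x).1 h),
    fun h => not_congr ((concat_lt_concat w y x).2 h)⟩

theorem eq_concat_of_between (w : List ℕ) {x y z : ℕ → ℕ} (h1 : AltLE (concat w y) x)
    (h2 : AltLE x (concat w z)) : ∃ x', x = concat w x' := by
  induction w generalizing x y z with
  | nil => exact ⟨x, by simp⟩
  | cons j w ih =>
    have e1 := h1.head_le
    have e2 := h2.head_le
    rw [concat_cons_zero] at e1 e2
    have t1 := h1.tail (by rw [concat_cons_zero]; omega)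
    have t2 := h2.tail (by rw [concat_cons_zero]; omega)
    rw [shift_one_concat_cons] at t1 t2
    obtain ⟨x', hx'⟩ := ih t2 t1
    exact ⟨x', word_ext (by rw [concat_cons_zero]; omega) (by simpa using hx')⟩

theorem concat_rep {w : List ℕ} (hw : w ≠ []) : concat w (rep w) = rep w := by
  have hl : 0 < w.length := List.length_pos_iff.2 hw
  funext i
  by_cases h : i < w.length
  · simp [concat, rep, h, Nat.mod_eq_of_lt h]
  · simp only [concat, rep, h, if_false]
    congr 1
    rw [← Nat.mod_eq_sub_mod (by omega)]

theorem rep_pre {a : ℕ → ℕ} {k : ℕ} (hk : 0 < k) (ha : Function.Periodic a k) :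
    rep (pre a k) = a := by
  funext i
  have : i % k < k := Nat.mod_lt _ hk
  simp [rep, pre, List.getD, this, ha.map_mod_nat]

/-- A coinduction principle: every position is reached after stripping finitely many copies of `w`.
-/
theorem eq_rep_of_forall {w : List ℕ} (hw : w ≠ []) {S : Set (ℕ → ℕ)}
    (hS : ∀ x ∈ S, ∃ y ∈ S, x = concat w y) {x : ℕ → ℕ} (hx : x ∈ S) : x = rep w := by
  have hl : 0 < w.length := List.length_pos_iff.2 hw
  funext i
  induction i using Nat.strong_induction_on generalizing x with
  | _ i ih =>
    obtain ⟨y, hy, rfl⟩ := hS x hx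
    rw [← concat_rep hw]
    by_cases h : i < w.length
    · simp [concat, h]
    · simp only [concat, h, if_false]
      exact ih _ (by omega) hy

/-! ### The morphism on infinite words -/

/-- The morphism `0 ↦ 1`, `1 ↦ 100` applied to an infinite word; all nonzero letters are treated
like `1`. -/
def phiW : (ℕ → ℕ) → ℕ → ℕ
  | _, 0 => 1
  | x, 1 => if x 0 = 0 then 1 else 0
  | x, 2 => if x 0 = 0 then phiW (shift 1 x) 1 else 0
  | x, i + 3 => if x 0 = 0 then phiW (shift 1 x) (i + 2) else phiW (shift 1 x) i

/-- The morphism on finite words over the natural numbers. -/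
def phiL (w : List ℕ) : List ℕ := w.flatMap fun j => if j = 0 then [1] else [1, 0, 0]

/-- Words with letters in `{0, 1}`. -/
def Binary (x : ℕ → ℕ) : Prop := ∀ i, x i ≤ 1

theorem Binary.shift {x : ℕ → ℕ} (hx : Binary x) (n : ℕ) : Binary (shift n x) := fun i => hx (i + n)

@[simp] theorem phiW_zero (x : ℕ → ℕ) : phiW x 0 = 1 := by rw [phiW]

theorem phiW_one (x : ℕ → ℕ) : phiW x 1 = if x 0 = 0 then 1 else 0 := by rw [phiW]

theorem shift_phiW_of_eq {x : ℕ → ℕ} (h : x 0 = 0) : shift 1 (phiW x) = phiW (shift 1 x) := by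
  funext i
  match i with
  | 0 => simp [shift, phiW, h]
  | 1 => simp [shift, phiW, h]
  | i + 2 => simp [shift, phiW, h]

theorem phiW_two_of_ne {x : ℕ → ℕ} (h : x 0 ≠ 0) : phiW x 2 = 0 := by rw [phiW]; simp [h]

theorem shift_phiW_of_ne {x : ℕ → ℕ} (h : x 0 ≠ 0) : shift 3 (phiW x) = phiW (shift 1 x) := by
  funext i
  simp [shift, phiW, h]

theorem phiW_eq_of_eq {x : ℕ → ℕ} (h : x 0 = 0) : phiW x = concat [1] (phiW (shift 1 x)) :=
  word_ext (by simp) (by rw [shift_one_concat_cons, concat_nil, shift_phiW_of_eq h])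

theorem phiW_eq_of_ne {x : ℕ → ℕ} (h : x 0 ≠ 0) : phiW x = concat [1, 0, 0] (phiW (shift 1 x)) := by
  rw [← shift_phiW_of_ne h]
  conv_lhs => rw [← concat_pre_shift (phiW x) 3]
  simp [pre, List.range_succ, phiW_one, phiW_two_of_ne h, h]

theorem phiW_concat (w : List ℕ) (x : ℕ → ℕ) : phiW (concat w x) = concat (phiL w) (phiW x) := by
  induction w with
  | nil => simp [phiL]
  | cons j w ih =>
    have hL : phiL (j :: w) = (if j = 0 then [1] else [1, 0, 0]) ++ phiL w := by simp [phiL]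
    rw [hL, concat_append, ← ih]
    by_cases h : j = 0
    · rw [phiW_eq_of_eq (by simpa using h)]; simp [h]
    · rw [phiW_eq_of_ne (by simpa using h)]; simp [h]

theorem shift_phiW (x : ℕ → ℕ) (m : ℕ) :
    shift (phiL (pre x m)).length (phiW x) = phiW (shift m x) := by
  conv_lhs => rw [← concat_pre_shift x m, phiW_concat]
  rw [concat_pre_shift, shift_length_concat]

theorem phiL_append (w w' : List ℕ) : phiL (w ++ w') = phiL w ++ phiL w' := by simp [phiL]

theorem length_le_length_phiL (w : List ℕ) : w.length ≤ (phiL w).length := by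
  induction w with
  | nil => simp
  | cons j w ih =>
    have hL : phiL (j :: w) = (if j = 0 then [1] else [1, 0, 0]) ++ phiL w := by simp [phiL]
    rw [hL]
    split_ifs <;> simp <;> omega

theorem even_length_phiL (w : List ℕ) : Even (phiL w).length ↔ Even w.length := by
  induction w with
  | nil => simp [phiL]
  | cons j w ih =>
    have hL : phiL (j :: w) = (if j = 0 then [1] else [1, 0, 0]) ++ phiL w := by simp [phiL]
    rw [hL]
    split_ifs
    · simp [Nat.even_add_one, ih]
    · simp only [List.length_append, List.length_cons, List.length_nil]
      rw [show 0 + 1 + 1 + 1 + (phiL w).length = (phiL w).length + 1 + 2 by ring,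
        Nat.even_add_one, Nat.even_add (n := 2)]
      simp [Nat.even_add_one, ih]

theorem phiW_binary (x : ℕ → ℕ) : Binary (phiW x) := by
  intro i
  induction i using Nat.strong_induction_on generalizing x with
  | _ i ih =>
    match i with
    | 0 => simp
    | 1 => rw [phiW]; split_ifs <;> omega
    | 2 => rw [phiW]; split_ifs; exacts [ih 1 (by omega) _, by omega]
    | i + 3 => rw [phiW]; split_ifs; exacts [ih _ (by omega) _, ih _ (by omega) _]

/-- The extra letter of agreement comes from the fact that the image of any letter begins with `1`.
-/
theorem phiW_agree {x y : ℕ → ℕ} {j : ℕ} (h : ∀ i < j, x i = y i) :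
    ∀ i < j + 1, phiW x i = phiW y i := by
  induction j generalizing x y with
  | zero => intro i hi; obtain rfl : i = 0 := by omega
            simp
  | succ j ih =>
    intro i hi
    have ih' := ih (x := shift 1 x) (y := shift 1 y) (fun i hi => h (i + 1) (by omega))
    have h0 := h 0 (by omega)
    by_cases hx : x 0 = 0
    · rw [phiW_eq_of_eq (x := x) hx, phiW_eq_of_eq (x := y) (h0 ▸ hx)]
      cases i with
      | zero => simp
      | succ i => simpa [concat] using ih' i (by omega)
    · rw [phiW_eq_of_ne (x := x) hx, phiW_eq_of_ne (x := y) (h0 ▸ hx)]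
      simp only [concat]
      split_ifs with h3
      · rfl
      · simp at h3 ⊢
        exact ih' _ (by omega)

/-- The second letter of the image reveals the first letter of the word, and a letter has an image
of length at most `3`. -/
theorem agree_of_phiW_agree {x y : ℕ → ℕ} (hx : Binary x) (hy : Binary y) {j : ℕ}
    (h : ∀ i < 3 * j, phiW x i = phiW y i) : ∀ i < j, x i = y i := by
  induction j generalizing x y with
  | zero => intro i hi; omega
  | succ j ih =>
    have h1 := h 1 (by omega)
    rw [phiW_one, phiW_one] at h1
    have hx0 := hx 0
    have hy0 := hy 0
    have h0 : x 0 = y 0 := by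
      split_ifs at h1 <;> omega
    intro i hi
    cases i with
    | zero => exact h0
    | succ i =>
      refine ih (hx.shift 1) (hy.shift 1) (fun i hi => ?_) i (by omega)
      by_cases hz : x 0 = 0
      · rw [← shift_phiW_of_eq hz, ← shift_phiW_of_eq (h0 ▸ hz)]
        exact h _ (by omega)
      · rw [← shift_phiW_of_ne hz, ← shift_phiW_of_ne (h0 ▸ hz)]
        exact h _ (by omega)

theorem phiW_injective {x y : ℕ → ℕ} (hx : Binary x) (hy : Binary y) (h : phiW x = phiW y) :
    x = y := by
  funext i
  exact agree_of_phiW_agree hx hy (j := i + 1) (fun i _ => congrFun h i) i (by omega)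

/-- Both images have odd length, so common prefixes keep their parity. At the first difference `100`
meets `1` followed by another image, that is `11`, so the comparison moves one place to the right
and the inequality keeps its direction. -/
theorem phiW_lt {x y : ℕ → ℕ} (hx : Binary x) (hy : Binary y) (h : AltLT x y) :
    AltLT (phiW x) (phiW y) := by
  refine AltLT.induct (P := fun x y => Binary x → Binary y → AltLT (phiW x) (phiW y)) ?_ ?_ h hx hy
  · intro x y hxy hx hy
    rw [phiW_eq_of_ne (x := x) (by omega), phiW_eq_of_eq (x := y) (by have := hx 0; omega),
      altLT_iff]
    right
    simp only [concat_cons_zero, shift_one_concat_cons, true_and, concat_nil]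
    rw [altLT_iff]
    left
    simp
  · intro x y h0 _ ih hx hy
    have ih := ih (hy.shift 1) (hx.shift 1)
    by_cases hz : x 0 = 0
    · rw [phiW_eq_of_eq (x := x) hz, phiW_eq_of_eq (x := y) (h0 ▸ hz)]
      exact ((concat_lt_concat [1] _ _).2 (by decide)).2 ih
    · rw [phiW_eq_of_ne (x := x) hz, phiW_eq_of_ne (x := y) (h0 ▸ hz)]
      exact ((concat_lt_concat [1, 0, 0] _ _).2 (by decide)).2 ih

theorem phiW_lt_iff {x y : ℕ → ℕ} (hx : Binary x) (hy : Binary y) :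
    AltLT (phiW x) (phiW y) ↔ AltLT x y := by
  refine ⟨fun h => ?_, phiW_lt hx hy⟩
  rcases altLT_trichotomy x y with h' | rfl | h'
  · exact h'
  · exact absurd h (altLT_irrefl _)
  · exact absurd (h.trans (phiW_lt hy hx h')) (altLT_irrefl _)

theorem phiW_le_iff {x y : ℕ → ℕ} (hx : Binary x) (hy : Binary y) :
    AltLE (phiW x) (phiW y) ↔ AltLE x y := by
  rw [← not_altLT, phiW_lt_iff hy hx, not_altLT]

/-- The letter `1` occurs in an image only at the start of a block, so a tail beginning with `1` is
itself an image. -/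
theorem exists_shift_phiW {x : ℕ → ℕ} {n : ℕ} (h : phiW x n = 1) :
    ∃ m, (phiL (pre x m)).length = n ∧ shift n (phiW x) = phiW (shift m x) := by
  suffices H : ∃ m, (phiL (pre x m)).length = n by
    obtain ⟨m, hm⟩ := H
    exact ⟨m, hm, by rw [← hm, shift_phiW]⟩
  have hpre : ∀ (x : ℕ → ℕ) (m : ℕ), pre x (m + 1) = x 0 :: pre (shift 1 x) m := by
    intro x m
    simp [pre, List.range_succ_eq_map, shift, Function.comp_def]
  have hL : ∀ j w, phiL (j :: w) = (if j = 0 then [1] else [1, 0, 0]) ++ phiL w := by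
    intro j w; simp [phiL]
  induction n using Nat.strong_induction_on generalizing x with
  | _ n ih =>
    by_cases hx : x 0 = 0
    · cases n with
      | zero => exact ⟨0, by simp [pre, phiL]⟩
      | succ n =>
        rw [show phiW x (n + 1) = shift 1 (phiW x) n from rfl, shift_phiW_of_eq hx] at h
        obtain ⟨m, hm⟩ := ih n (by omega) h
        refine ⟨m + 1, ?_⟩
        rw [hpre, hL, List.length_append, hm, if_pos hx]
        simp [add_comm]
    · match n with
      | 0 => exact ⟨0, by simp [pre, phiL]⟩
      | 1 => simp [phiW_one, hx] at h
      | 2 => simp [phiW_two_of_ne hx] at h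
      | n + 3 =>
        rw [show phiW x (n + 3) = shift 3 (phiW x) n from rfl, shift_phiW_of_ne hx] at h
        obtain ⟨m, hm⟩ := ih n (by omega) h
        refine ⟨m + 1, ?_⟩
        rw [hpre, hL, List.length_append, hm, if_neg hx]
        simp [add_comm]

/-! ### The fixed point of the morphism -/

theorem map_val_phi (w : List (Fin 2)) :
    (phi w).map (fun j : Fin 2 => (j : ℕ)) = phiL (w.map fun j : Fin 2 => (j : ℕ)) := by
  induction w with
  | nil => simp [phi, phiL]
  | cons j w ih =>
    have h1 : phi (j :: w) = phiLetter j ++ phi w := by simp [phi]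
    have h2 : ∀ (j : ℕ) (w : List ℕ),
      phiL (j :: w) = (if j = 0 then [1] else [1, 0, 0]) ++ phiL w := by simp [phiL]
    rw [h1, List.map_append, ih, List.map_cons, h2]
    congr 1
    fin_cases j <;> simp [phiLetter]

theorem phi_append (w w' : List (Fin 2)) : phi (w ++ w') = phi w ++ phi w' := by simp [phi]

theorem iterate_phi_prefix_succ (n : ℕ) : phi^[n] [1] <+: phi^[n + 1] [1] := by
  induction n with
  | zero => exact ⟨[0, 0], rfl⟩
  | succ n ih =>
    rw [Function.iterate_succ_apply', Function.iterate_succ_apply' (n := n + 1)]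
    obtain ⟨t, ht⟩ := ih
    exact ⟨phi t, by rw [← phi_append, ht]⟩

theorem iterate_phi_prefix {m n : ℕ} (h : m ≤ n) : phi^[m] [1] <+: phi^[n] [1] := by
  induction n, h using Nat.le_induction with
  | base => exact List.prefix_rfl
  | succ n _ ih => exact ih.trans (iterate_phi_prefix_succ n)

theorem lt_length_iterate_phi (n : ℕ) : n < (phi^[n] [1]).length := by
  induction n with
  | zero => simp
  | succ n ih =>
    obtain ⟨t, ht⟩ : [1] <+: phi^[n] [1] := iterate_phi_prefix (Nat.zero_le n)
    rw [Function.iterate_succ_apply', ← ht, phi_append]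
    rw [← ht] at ih
    have hl := length_le_length_phiL (t.map fun j : Fin 2 => (j : ℕ))
    rw [← map_val_phi, List.length_map, List.length_map] at hl
    have h1 : (phi [1]).length = 3 := rfl
    simp only [List.length_append, List.length_cons, List.length_nil, h1] at ih ⊢
    omega

theorem phiInf_eq_getD {n i : ℕ} (hi : i < (phi^[n] [1]).length) :
    phiInf i = ((phi^[n] [1]).map (fun j : Fin 2 => (j : ℕ))).getD i 0 := by
  have hi' := lt_length_iterate_phi i
  have key : (phi^[i] [1])[i] = (phi^[n] [1])[i] := by
    rcases le_total i n with h | h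
    · exact (iterate_phi_prefix h).getElem hi'
    · exact ((iterate_phi_prefix h).getElem hi).symm
  simp [phiInf, List.getD, hi, hi', key]

theorem phiInf_eq_concat (n : ℕ) :
    phiInf = concat ((phi^[n] [1]).map (fun j : Fin 2 => (j : ℕ)))
      (shift (phi^[n] [1]).length phiInf) := by
  funext i
  by_cases h : i < (phi^[n] [1]).length
  · rw [phiInf_eq_getD h]
    simp [concat, h]
  · simp only [concat, List.length_map, h, if_false, shift]
    congr 1
    omega

theorem phiW_phiInf : phiW phiInf = phiInf := by
  funext i
  have h1 := phiInf_eq_concat i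
  have h2 : i < (phi^[i + 1] [1]).length := (Nat.lt_succ_self i).trans (lt_length_iterate_phi _)
  rw [h1, phiW_concat, ← map_val_phi, ← Function.iterate_succ_apply' phi, ← h1, phiInf_eq_getD h2]
  simp only [concat, List.length_map, h2, if_true]

theorem phiInf_binary : Binary phiInf := by
  rw [← phiW_phiInf]; exact phiW_binary _

theorem phiInf_zero : phiInf 0 = 1 := by rw [← phiW_phiInf, phiW_zero]

theorem phiInf_eq : phiInf = concat [1, 0, 0, 1] (shift 4 phiInf) := by
  have h : phiInf = concat [1, 0, 0] (phiW (shift 1 phiInf)) := by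
    conv_lhs => rw [← phiW_phiInf]
    exact phiW_eq_of_ne (by rw [phiInf_zero]; omega)
  have e1 : phiInf 1 = 0 := by rw [h]; simp [concat]
  have e2 : phiInf 2 = 0 := by rw [h]; simp [concat]
  have e3 : phiInf 3 = 1 := by rw [h]; simp [concat]
  conv_lhs => rw [← concat_pre_shift phiInf 4]
  simp [pre, List.range_succ, phiInf_zero, e1, e2, e3]

/-- A smaller tail would begin with `1`, hence be the image of an earlier tail that is also smaller.
The position drops because the first letter `1` has an image of length `3`. -/
theorem phiInf_lyndon : IsAltLyndon phiInf := by
  intro n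
  rw [← not_altLT]
  induction n using Nat.strong_induction_on with
  | _ n ih =>
    intro h
    rcases Nat.eq_zero_or_pos n with rfl | hn
    · exact altLT_irrefl _ h
    have h0 := h.le.head_le
    have h1 : phiW phiInf n = 1 := by
      rw [phiW_phiInf]
      have := phiInf_binary n
      rw [phiInf_zero, shift, zero_add] at h0
      omega
    obtain ⟨m, hm, hs⟩ := exists_shift_phiW h1
    rw [phiW_phiInf] at hs
    have h2 : AltLT (phiW (shift m phiInf)) (phiW phiInf) := by rwa [phiW_phiInf, ← hs]
    rw [phiW_lt_iff (phiInf_binary.shift m) phiInf_binary] at h2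
    refine ih m ?_ h2
    cases m with
    | zero => simp [pre, phiL] at hm; omega
    | succ m =>
      have hpre : pre phiInf (m + 1) = phiInf 0 :: pre (shift 1 phiInf) m := by
        simp [pre, List.range_succ_eq_map, shift, Function.comp_def]
      have hL : phiL (1 :: pre (shift 1 phiInf) m) = [1, 0, 0] ++ phiL (pre (shift 1 phiInf) m) := by
        simp [phiL]
      rw [hpre, phiInf_zero, hL] at hm
      have := length_le_length_phiL (pre (shift 1 phiInf) m)
      simp at hm this
      omega

/-! ### Desubstitution -/

/-- The condition says that every `10` extends to `1001`, so the word can be cut into blocks `1` and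
`100`, each followed by a `1`. -/
theorem exists_eq_phiW {x : ℕ → ℕ} (hx : Binary x) (h0 : x 0 = 1)
    (h : ∀ n, x n = 1 → x (n + 1) = 0 → x (n + 2) = 0 ∧ x (n + 3) = 1) :
    ∃ e, Binary e ∧ x = phiW e := by
  set Good : (ℕ → ℕ) → Prop := fun x => Binary x ∧ x 0 = 1 ∧
    ∀ n, x n = 1 → x (n + 1) = 0 → x (n + 2) = 0 ∧ x (n + 3) = 1 with hGood
  let step : (ℕ → ℕ) → (ℕ → ℕ) := fun x => if x 1 = 1 then shift 1 x else shift 3 x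
  -- `step` removes one block; the second letter of what remains is `1` for the block `1 = φ(0)` and
  -- `0` for the block `100 = φ(1)`.
  let e : (ℕ → ℕ) → (ℕ → ℕ) := fun x n => 1 - (step^[n] x) 1
  have hstep : ∀ x, Good x → Good (step x) := by
    rintro x ⟨hb, hx0, hx⟩
    by_cases h1 : x 1 = 1
    · simp only [step, h1, if_true]
      exact ⟨hb.shift 1, h1, fun n => hx (n + 1)⟩
    · simp only [step, h1, if_false]
      have := hb 1
      exact ⟨hb.shift 3, (hx 0 hx0 (by simp only [zero_add]; omega)).2, fun n => hx (n + 3)⟩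
  have he : ∀ x, shift 1 (e x) = e (step x) := fun x => by
    funext n; simp only [shift, e, Function.iterate_succ_apply]
  have key : ∀ i x, Good x → phiW (e x) i = x i := by
    intro i
    induction i using Nat.strong_induction_on with
    | _ i ih =>
      intro x hgx
      have hgs := hstep x hgx
      obtain ⟨hb, hx0, hx⟩ := hgx
      have e0 : e x 0 = 1 - x 1 := rfl
      have hb1 := hb 1
      by_cases h1 : x 1 = 1
      · rw [phiW_eq_of_eq (by omega), he]
        cases i with
        | zero => simp [hx0]
        | succ i =>
          have := ih i (by omega) _ hgs
          simp only [step, h1, if_true] at this ⊢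
          simpa [concat, shift] using this
      · rw [phiW_eq_of_ne (by omega), he]
        have hx1 : x 1 = 0 := by omega
        match i with
        | 0 => simp [hx0]
        | 1 => simp [concat, hx1]
        | 2 => simp [concat, (hx 0 hx0 hx1).1]
        | i + 3 =>
          have := ih i (by omega) _ hgs
          simp only [step, h1, if_false] at this ⊢
          simpa [concat, shift] using this
  exact ⟨e x, fun i => by simp only [e]; omega, funext fun i => (key i x ⟨hx, h0, h⟩).symm⟩

theorem lyndon_of_phiW {e : ℕ → ℕ} (he : Binary e) (h : IsAltLyndon (phiW e)) : IsAltLyndon e := by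
  intro n
  rw [← phiW_le_iff he (he.shift n), ← shift_phiW]
  exact h _

/-- In an alternate Lyndon word that is at least `1001⋯`, neither `101` nor `1000` occurs. -/
theorem exists_eq_phiW_of_lyndon {d y : ℕ → ℕ} (hd : Binary d) (hl : IsAltLyndon d) (h0 : d 0 = 1)
    (h : AltLE (concat [1, 0, 0, 1] y) d) : ∃ e, Binary e ∧ IsAltLyndon e ∧ d = phiW e := by
  obtain ⟨e, he, rfl⟩ := exists_eq_phiW hd h0 (fun n hn hn1 => by
    have h1 := h.trans (hl n)
    have b2 := hd (n + 2)
    have t1 := h1.tail (by simp [shift, hn])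
    rw [shift_one_concat_cons, shift_shift, add_comm] at t1
    have t2 := t1.tail (by rw [concat_cons_zero, shift, zero_add, hn1])
    rw [shift_one_concat_cons, shift_shift, show 1 + (n + 1) = n + 2 by omega] at t2
    have h2 : d (n + 2) = 0 := by
      have := t2.head_le
      rw [concat_cons_zero, shift, zero_add] at this
      omega
    refine ⟨h2, ?_⟩
    have t3 := t2.tail (by rw [concat_cons_zero, shift, zero_add, h2])
    rw [shift_one_concat_cons, shift_shift, show 1 + (n + 2) = n + 3 by omega] at t3
    have := t3.head_le
    have b3 := hd (n + 3)
    rw [concat_cons_zero, shift, zero_add] at this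
    omega)
  exact ⟨e, he, lyndon_of_phiW he hl, rfl⟩

/-! ### Words below the fixed point -/

theorem iterate_phiW_binary {x : ℕ → ℕ} (hx : Binary x) (m : ℕ) : Binary (phiW^[m] x) := by
  cases m with
  | zero => exact hx
  | succ m => rw [Function.iterate_succ_apply']; exact phiW_binary _

theorem iterate_phiW_agree {x y : ℕ → ℕ} (m : ℕ) : ∀ i < m, phiW^[m] x i = phiW^[m] y i := by
  induction m with
  | zero => intro i hi; omega
  | succ m ih =>
    rw [Function.iterate_succ_apply', Function.iterate_succ_apply']
    exact phiW_agree ih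

theorem agree_of_iterate_phiW_agree {x y : ℕ → ℕ} (hx : Binary x) (hy : Binary y) (m : ℕ) {j : ℕ}
    (h : ∀ i < 3 ^ m * j, phiW^[m] x i = phiW^[m] y i) : ∀ i < j, x i = y i := by
  induction m with
  | zero => intro i hi; exact h i (by simpa using hi)
  | succ m ih =>
    rw [Function.iterate_succ_apply', Function.iterate_succ_apply'] at h
    refine ih (agree_of_phiW_agree (iterate_phiW_binary hx m) (iterate_phiW_binary hy m) ?_)
    intro i hi
    exact h i (by rw [pow_succ]; linarith)

theorem alternating_le {x : ℕ → ℕ} (hx : Binary x) : AltLE (fun i => (i + 1) % 2) x := by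
  set g : ℕ → ℕ := fun i => (i + 1) % 2 with hg
  have hg2 : shift 1 (shift 1 g) = g := by funext i; simp [shift, hg]; omega
  have hgb : Binary g := fun i => by simp only [hg]; omega
  rw [← not_altLT]
  intro h
  -- The dual claim, that `0101⋯` is the greatest binary word, is carried along because the
  -- induction exchanges the words.
  refine (AltLT.induct (P := fun x y => Binary x → Binary y → y ≠ g ∧ x ≠ shift 1 g)
    ?_ ?_ h hx hgb).1 rfl
  · intro x y hxy hx hy
    have hx0 := hx 0
    refine ⟨?_, ?_⟩
    · rintro rfl
      simp [hg] at hxy; omega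
    · rintro rfl
      simp [shift, hg] at hxy
  · intro x y h0 _ ih hx hy
    obtain ⟨ih1, ih2⟩ := ih (hy.shift 1) (hx.shift 1)
    refine ⟨?_, ?_⟩
    · rintro rfl
      exact ih2 rfl
    · rintro rfl
      exact ih1 hg2

/-- A tail starting with `0` is larger than any word starting with `1`; a tail starting with `1` can
be desubstituted. -/
theorem iterate_phiW_alternating_le {x : ℕ → ℕ} (hx : Binary x) (m n : ℕ) :
    AltLE (phiW^[m] fun i => (i + 1) % 2) (shift n (phiW^[m] x)) := by
  induction m generalizing n with
  | zero => exact alternating_le (hx.shift n)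
  | succ m ih =>
    rw [Function.iterate_succ_apply', Function.iterate_succ_apply']
    set y := phiW^[m] x with hy
    have hyb : Binary y := iterate_phiW_binary hx m
    by_cases h : phiW y n = 1
    · obtain ⟨k, -, hs⟩ := exists_shift_phiW h
      rw [hs, phiW_le_iff (iterate_phiW_binary (fun i => by omega) m) (hyb.shift k)]
      exact ih k
    · rw [altLE_iff]
      left
      have := phiW_binary y n
      simp [shift]
      omega

/-- `φ^m(1010⋯)` and `φ^∞(1)`, which is fixed by `φ^m`, agree on `m` letters. Once `m` exceeds the
place where `d` leaves `φ^∞(1)`, `d` lies below `φ^m(1010⋯)`, the lower bound for all these tails.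
-/
theorem exists_iterate_phiW_lt {d : ℕ → ℕ} (hd : AltLT d phiInf) :
    ∃ m, ∀ x, Binary x → ∀ n, AltLT d (shift n (phiW^[m] x)) := by
  obtain ⟨k, hk, hlt⟩ := hd
  refine ⟨k + 1, fun x hx n => AltLT.trans_le ?_ (iterate_phiW_alternating_le hx (k + 1) n)⟩
  have hfix : phiW^[k + 1] phiInf = phiInf := Function.iterate_fixed phiW_phiInf _
  have hag := iterate_phiW_agree (x := phiInf) (y := fun i => (i + 1) % 2) (k + 1)
  rw [hfix] at hag
  refine ⟨k, fun i hi => ?_, ?_⟩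
  · rw [hk i hi, hag i (by omega)]
  · rw [← hag k (by omega)]; exact hlt

/-! ### The value of a word -/

/-- The value of the word `x` in base `-s`, as an offset from the left end point `l_s`. -/
noncomputable def val (s : ℝ) (x : ℕ → ℕ) : ℝ := ∑' i, (-1 / s) ^ i * (1 - (x i : ℝ) / s)

/-- Words with bounded letters. -/
def Bdd (x : ℕ → ℕ) : Prop := ∃ M : ℕ, ∀ i, x i ≤ M

theorem Bdd.shift {x : ℕ → ℕ} (hx : Bdd x) (n : ℕ) : Bdd (shift n x) :=
  hx.imp fun _ hM i => hM (i + n)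

theorem Binary.bdd {x : ℕ → ℕ} (hx : Binary x) : Bdd x := ⟨1, hx⟩

theorem IsAltLyndon.le_head {x : ℕ → ℕ} (hx : IsAltLyndon x) (i : ℕ) : x i ≤ x 0 := by
  simpa [NegBeta.shift] using (hx i).head_le

theorem IsAltLyndon.bdd {x : ℕ → ℕ} (hx : IsAltLyndon x) : Bdd x := ⟨x 0, hx.le_head⟩

theorem Bdd.concat {x : ℕ → ℕ} (hx : Bdd x) (w : List ℕ) : Bdd (concat w x) := by
  obtain ⟨M, hM⟩ := hx
  refine ⟨M + w.sum, fun i => ?_⟩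
  simp only [NegBeta.concat]
  split_ifs with h
  · have : w.getD i 0 ≤ w.sum := by
      rw [List.getD_eq_getElem _ _ h]
      exact List.single_le_sum (by simp) _ (List.getElem_mem h)
    omega
  · exact (hM _).trans (Nat.le_add_right _ _)

theorem abs_val_term_le {s : ℝ} (hs : 1 < s) {x : ℕ → ℕ} {M : ℕ} (hx : ∀ i, x i ≤ M) (i : ℕ) :
    |(-1 / s) ^ i * (1 - (x i : ℝ) / s)| ≤ (1 / s) ^ i * (1 + M) := by
  have hs0 : 0 < s := by linarith
  rw [abs_mul, abs_pow, abs_div, abs_neg, abs_one, abs_of_pos hs0]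
  gcongr
  have h1 : (x i : ℝ) / s ≤ M := by
    rw [div_le_iff₀ hs0]
    have : (x i : ℝ) ≤ M := by exact_mod_cast hx i
    nlinarith [Nat.cast_nonneg (α := ℝ) M]
  have h2 : 0 ≤ (x i : ℝ) / s := by positivity
  rw [abs_le]
  constructor <;> linarith [Nat.cast_nonneg (α := ℝ) M]

theorem summable_geom_bound {s : ℝ} (hs : 1 < s) (C : ℝ) :
    Summable fun i : ℕ => (1 / s) ^ i * C := by
  apply Summable.mul_right
  exact summable_geometric_of_lt_one (by positivity) (by rw [div_lt_one] <;> linarith)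

theorem summable_val {s : ℝ} (hs : 1 < s) {x : ℕ → ℕ} (hx : Bdd x) :
    Summable fun i => (-1 / s) ^ i * (1 - (x i : ℝ) / s) := by
  obtain ⟨M, hM⟩ := hx
  exact Summable.of_norm_bounded (summable_geom_bound hs (1 + M)) (abs_val_term_le hs hM)

/-- This is the orbit relation `t_{i+1} = s(1 - t_i) - x_i` solved for `t_i`. -/
theorem val_rec {s : ℝ} (hs : 1 < s) {x : ℕ → ℕ} (hx : Bdd x) :
    val s x = 1 - ((x 0 : ℝ) + val s (shift 1 x)) / s := by
  have hs0 : s ≠ 0 := by linarith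
  have h : ∀ i, (-1 / s) ^ (i + 1) * (1 - (x (i + 1) : ℝ) / s) =
      (-1 / s) * ((-1 / s) ^ i * (1 - (shift 1 x i : ℝ) / s)) := by
    intro i; rw [pow_succ]; simp only [shift]; ring
  rw [val, (summable_val hs hx).tsum_eq_zero_add]
  simp only [h]
  rw [tsum_mul_left, ← val]
  simp only [pow_zero]
  field_simp
  ring

theorem abs_val_le {s : ℝ} (hs : 1 < s) {x : ℕ → ℕ} {M : ℕ} (hx : ∀ i, x i ≤ M) :
    |val s x| ≤ ∑' i : ℕ, (1 / s) ^ i * (1 + (M : ℝ)) := by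
  exact tsum_of_norm_bounded (f := fun i => (-1 / s) ^ i * (1 - (x i : ℝ) / s))
    (summable_geom_bound hs (1 + (M : ℝ))).hasSum (abs_val_term_le hs hx)

/-- Following the chain of witnesses `y` bounds `|f x|` by `r ^ n * K` for every `n`. It replaces
the summation of series over infinite block decompositions. -/
theorem eq_zero_of_contraction {α : Type*} {S : Set α} {f : α → ℝ} {K r : ℝ} (hr : 0 ≤ r)
    (hr1 : r < 1) (hK : ∀ x ∈ S, |f x| ≤ K) (h : ∀ x ∈ S, ∃ y ∈ S, |f x| ≤ r * |f y|) :
    ∀ x ∈ S, f x = 0 := by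
  have key : ∀ n : ℕ, ∀ x ∈ S, |f x| ≤ r ^ n * K := by
    intro n
    induction n with
    | zero => simpa using hK
    | succ n ih =>
      intro x hx
      obtain ⟨y, hy, hxy⟩ := h x hx
      calc |f x| ≤ r * |f y| := hxy
        _ ≤ r * (r ^ n * K) := by gcongr; exact ih y hy
        _ = _ := by ring
  intro x hx
  have hlim : Filter.Tendsto (fun n : ℕ => r ^ n * K) Filter.atTop (nhds (0 * K)) :=
    (tendsto_pow_atTop_nhds_zero_of_lt_one hr hr1).mul_const K
  rw [zero_mul] at hlim
  have := ge_of_tendsto' hlim (fun n => key n x hx)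
  exact abs_eq_zero.1 (le_antisymm this (abs_nonneg _))

/-- The orbit relation has only one bounded solution, since differences shrink by the factor `1 /
s`. -/
theorem val_shift_eq {s : ℝ} (hs : 1 < s) {x : ℕ → ℕ} (hx : Bdd x) {t : ℕ → ℝ} {K : ℝ}
    (hK : ∀ i, |t i| ≤ K) (h : ∀ i, t i = 1 - ((x i : ℝ) + t (i + 1)) / s) (i : ℕ) :
    val s (shift i x) = t i := by
  obtain ⟨M, hM⟩ := id hx
  have hs0 : 0 < s := by linarith
  have := eq_zero_of_contraction (S := (Set.univ : Set ℕ))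
    (f := fun i => val s (shift i x) - t i) (r := 1 / s)
    (K := (∑' i : ℕ, (1 / s) ^ i * (1 + (M : ℝ))) + K) (by positivity)
    (by rw [div_lt_one] <;> linarith) ?_ ?_ i (Set.mem_univ _)
  · linarith
  · intro i _
    exact (abs_sub _ _).trans
      (add_le_add (abs_val_le hs (M := M) fun j => hM (j + i)) (hK i))
  · intro i _
    refine ⟨i + 1, Set.mem_univ _, le_of_eq ?_⟩
    rw [val_rec hs (hx.shift i), h i, shift_shift, add_comm 1 i]
    rw [show shift i x 0 = x i by simp [shift],
      show (1 : ℝ) - ((x i : ℝ) + val s (shift (i + 1) x)) / s - (1 - ((x i : ℝ) + t (i + 1)) / s)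
      = -(1 / s) * (val s (shift (i + 1) x) - t (i + 1)) by ring, abs_mul, abs_neg,
      abs_of_pos (by positivity : (0 : ℝ) < 1 / s)]

theorem val_concat_sub {s : ℝ} (hs : 1 < s) (w : List ℕ) {x y : ℕ → ℕ} (hx : Bdd x) (hy : Bdd y) :
    val s (concat w x) - val s (concat w y) = (-1 / s) ^ w.length * (val s x - val s y) := by
  induction w with
  | nil => simp
  | cons j w ih =>
    rw [val_rec hs (hx.concat _), val_rec hs (hy.concat _)]
    simp only [concat_cons_zero, shift_one_concat_cons, List.length_cons, pow_succ]
    rw [mul_right_comm, ← ih]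
    ring

/-! ### Words at least the fixed point have nonzero value -/

/-- `Y` is a function on binary words that behaves like the value of the image under an iterate of
the morphism. -/
def IsWeighted (Y : (ℕ → ℕ) → ℝ) (p b b' : ℝ) : Prop :=
  ∀ x, Binary x → (x 0 = 0 → Y x = p - Y (shift 1 x) / b) ∧
    (x 0 = 1 → Y x = p * (1 - 1 / b) - Y (shift 1 x) / b')

theorem isWeighted_val {s : ℝ} (hs : 1 < s) : IsWeighted (val s) 1 s s := by
  intro x hx
  have := val_rec hs hx.bdd
  refine ⟨fun h => ?_, fun h => ?_⟩
  · rw [this, h]; push_cast; ring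
  · rw [this, h]; push_cast; ring

/-- The shape is closed under `φ`: expanding along `100` gives the constant `p(1 - 1/b)(1 - 1/b')`
and multiplies the weights to `b' b²`. -/
theorem IsWeighted.phiW {Y : (ℕ → ℕ) → ℝ} {p b b' : ℝ} (h : IsWeighted Y p b b') (hb : b ≠ 0)
    (hb' : b' ≠ 0) : IsWeighted (fun x => Y (phiW x)) (p * (1 - 1 / b)) b' (b' * b ^ 2) := by
  intro x hx
  have hB := phiW_binary x
  beta_reduce
  refine ⟨fun h0 => ?_, fun h0 => ?_⟩
  · rw [(h _ hB).2 (phiW_zero x), shift_phiW_of_eq h0]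
  · have hne : x 0 ≠ 0 := by omega
    rw [(h _ hB).2 (phiW_zero x), (h _ (hB.shift 1)).1 (by simp [shift, phiW_one, hne]), shift_shift,
      (h _ (hB.shift _)).1 (by simp [shift, phiW_two_of_ne hne]), shift_shift, shift_phiW_of_ne hne]
    field_simp
    ring

/-- An alternate Lyndon word which is at least the fixed point and has value zero. -/
structure ZeroAbove (M : ℝ) (Y : (ℕ → ℕ) → ℝ) (p b b' : ℝ) (d : ℕ → ℕ) : Prop where
  weighted : IsWeighted Y p b b'
  p_pos : 0 < p
  one_lt : 1 < b
  le : b ≤ b'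
  bound : ∀ x, Binary x → |Y x| ≤ M
  binary : Binary d
  lyndon : IsAltLyndon d
  above : AltLE phiInf d
  zero : Y d = 0

theorem ZeroAbove.head {M : ℝ} {Y : (ℕ → ℕ) → ℝ} {p b b' : ℝ} {d : ℕ → ℕ}
    (h : ZeroAbove M Y p b b' d) : d 0 = 1 := by
  have hb := h.binary 0
  by_contra hne
  have h0 : d 0 = 0 := by omega
  have hall : ∀ i, d i = 0 := fun i => by have := h.lyndon.le_head i; omega
  have hs : shift 1 d = d := by funext i; simp [shift, hall]
  have := (h.weighted d h.binary).1 h0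
  rw [hs, h.zero] at this
  have := h.p_pos
  simp at *
  linarith

theorem ZeroAbove.step {M : ℝ} {Y : (ℕ → ℕ) → ℝ} {p b b' : ℝ} {d : ℕ → ℕ}
    (h : ZeroAbove M Y p b b' d) :
    ∃ e, ZeroAbove M (fun x => Y (phiW x)) (p * (1 - 1 / b)) b' (b' * b ^ 2) e := by
  have hab := h.above
  rw [phiInf_eq] at hab
  obtain ⟨e, he, hel, hde⟩ := exists_eq_phiW_of_lyndon h.binary h.lyndon h.head hab
  have h1 := h.one_lt
  have h2 := h.le
  refine ⟨e, h.weighted.phiW (by linarith) (by linarith), ?_, by linarith, ?_,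
    fun x _ => h.bound _ (phiW_binary x), he, hel, ?_, ?_⟩
  · apply mul_pos h.p_pos
    rw [sub_pos, div_lt_one] <;> linarith
  · exact le_mul_of_one_le_right (by linarith) (one_le_pow₀ h1.le)
  · rw [← phiW_le_iff phiInf_binary he, phiW_phiInf, ← hde]
    exact h.above
  · rw [← hde]; exact h.zero

theorem ZeroAbove.le_bound {M : ℝ} {Y : (ℕ → ℕ) → ℝ} {p b b' : ℝ} {d : ℕ → ℕ}
    (h : ZeroAbove M Y p b b' d) : p * (1 - 1 / b) * b' ≤ M := by
  have h1 := (h.weighted d h.binary).2 h.head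
  have h2 := h.bound _ (h.binary.shift 1)
  have h3 := h.one_lt
  have h4 := h.le
  rw [h.zero] at h1
  have h5 : p * (1 - 1 / b) * b' = Y (shift 1 d) := by
    rw [show p * (1 - 1 / b) = Y (shift 1 d) / b' by linarith, div_mul_cancel₀]
    linarith
  rw [h5]
  exact (le_abs_self _).trans h2

/-- The quantity `p(1 - 1/b)b'` is the value of the first tail, bounded by `M`. A desubstitution
multiplies it by `(1 - 1/b')b²`, which is at least `2` once `b ≥ 2`. -/
theorem ZeroAbove.mul_two_pow_le {M : ℝ} (n : ℕ) : ∀ {Y : (ℕ → ℕ) → ℝ} {p b b' : ℝ} {d : ℕ → ℕ},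
    ZeroAbove M Y p b b' d → 2 ≤ b → p * (1 - 1 / b) * b' * 2 ^ n ≤ M := by
  induction n with
  | zero => intro Y p b b' d h _; simpa using h.le_bound
  | succ n ih =>
    intro Y p b b' d h hb
    obtain ⟨e, he⟩ := h.step
    have hle := h.le
    have := ih he (by linarith)
    refine le_trans ?_ this
    have hp : 0 < p * (1 - 1 / b) := he.p_pos
    have h1 : 1 / b' ≤ 1 / 2 := one_div_le_one_div_of_le (by norm_num) (by linarith)
    have hfac : 2 ≤ (1 - 1 / b') * b ^ 2 := by nlinarith
    have hpos : 0 ≤ p * (1 - 1 / b) * b' * 2 ^ n := by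
      have : 0 < b' := by linarith
      positivity
    calc p * (1 - 1 / b) * b' * 2 ^ (n + 1) = (p * (1 - 1 / b) * b' * 2 ^ n) * 2 := by ring
      _ ≤ (p * (1 - 1 / b) * b' * 2 ^ n) * ((1 - 1 / b') * b ^ 2) := by gcongr
      _ = _ := by ring

theorem ZeroAbove.lt_two {M : ℝ} {Y : (ℕ → ℕ) → ℝ} {p b b' : ℝ} {d : ℕ → ℕ}
    (h : ZeroAbove M Y p b b' d) : b < 2 := by
  by_contra! hb
  obtain ⟨e, he⟩ := h.step
  have hpos : 0 < p * (1 - 1 / b) * b' := mul_pos he.p_pos (by linarith [h.le])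
  obtain ⟨n, hn⟩ := pow_unbounded_of_one_lt (M / (p * (1 - 1 / b) * b')) one_lt_two
  rw [div_lt_iff₀ hpos] at hn
  have := h.mul_two_pow_le n hb
  linarith

/-- Two desubstitutions turn `b` into `b' b² ≥ b r`, so the bound `b < 2` of `ZeroAbove.lt_two` is
eventually violated. -/
theorem ZeroAbove.mul_pow_lt_two {M r : ℝ} (hr : 1 < r) (n : ℕ) :
    ∀ {Y : (ℕ → ℕ) → ℝ} {p b b' : ℝ} {d : ℕ → ℕ},
    ZeroAbove M Y p b b' d → r ≤ b → b * r ^ n < 2 := by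
  induction n with
  | zero => intro Y p b b' d h _; simpa using h.lt_two
  | succ n ih =>
    intro Y p b b' d h hb
    obtain ⟨e, he⟩ := h.step
    obtain ⟨e', he'⟩ := he.step
    have hle := h.le
    have h1 : b * r ≤ b' * b ^ 2 := by
      calc b * r ≤ b' * b := by gcongr; linarith
        _ ≤ b' * b ^ 2 := by
          gcongr
          · linarith
          · nlinarith [h.one_lt]
    have h2 : r ≤ b' * b ^ 2 := by nlinarith
    have := ih he' h2
    calc b * r ^ (n + 1) = b * r * r ^ n := by ring
      _ ≤ b' * b ^ 2 * r ^ n := by gcongr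
      _ < 2 := this

/-- An alternate Lyndon word of value zero is smaller than the fixed point. -/
theorem lt_phiInf_of_val_eq_zero {s : ℝ} (hs : 1 < s) {d : ℕ → ℕ} (hd : IsAltLyndon d)
    (h0 : val s d = 0) : AltLT d phiInf := by
  by_contra hlt
  rw [not_altLT] at hlt
  have hhead := hlt.head_le
  rw [phiInf_zero] at hhead
  have hb : Binary d := fun i => (hd.le_head i).trans hhead
  have hz : ZeroAbove (∑' i : ℕ, (1 / s) ^ i * (1 + ((1 : ℕ) : ℝ))) (val s) 1 s s d :=
    ⟨isWeighted_val hs, one_pos, hs, le_rfl, fun x hx => abs_val_le hs hx, hb, hd, hlt, h0⟩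
  obtain ⟨n, hn⟩ := pow_unbounded_of_one_lt 2 hs
  have := hz.mul_pow_lt_two hs n le_rfl
  have h1 : 1 * s ^ n ≤ s * s ^ n := by gcongr
  linarith

/-! ### Expansions in terms of values -/

/-- Here `t i` is the distance of the `i`-th orbit point from the left end point, in which `T`
becomes `t ↦ fract (β(1 - t))`. -/
theorem isNegExpansion_iff_orbit {β : ℝ} (hβ : 1 < β) {d : ℕ → ℕ} :
    IsNegExpansion β (-β / (β + 1)) d ↔
      ∃ t : ℕ → ℝ, t 0 = 0 ∧ ∀ i, 0 ≤ t i ∧ t i < 1 ∧ t (i + 1) = β * (1 - t i) - d i := by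
  have hl : ∀ t, -β * (leftEnd β + t) - leftEnd β = β * (1 - t) := by
    intro t
    have : β + 1 ≠ 0 := by linarith
    rw [leftEnd]
    field_simp
    ring
  have hT : ∀ t, T β (leftEnd β + t) = leftEnd β + Int.fract (β * (1 - t)) := by
    intro t
    rw [T, hl, Int.fract]
    linarith [hl t]
  have hx0 : (-β / (β + 1)) = leftEnd β := rfl
  rw [hx0]
  constructor
  · intro h
    set t : ℕ → ℝ := fun i => (T β)^[i] (leftEnd β) - leftEnd β with ht
    have htl : ∀ i, (T β)^[i] (leftEnd β) = leftEnd β + t i := fun i => by simp [ht]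
    have hsucc : ∀ i, t (i + 1) = Int.fract (β * (1 - t i)) := by
      intro i
      have : t (i + 1) = (T β)^[i + 1] (leftEnd β) - leftEnd β := rfl
      rw [this, Function.iterate_succ_apply', htl, hT]
      ring
    refine ⟨t, by simp [ht], fun i => ⟨?_, ?_, ?_⟩⟩
    · cases i with
      | zero => simp [ht]
      | succ i => rw [hsucc]; exact Int.fract_nonneg _
    · cases i with
      | zero => simp [ht]
      | succ i => rw [hsucc]; exact Int.fract_lt_one _
    · have := h i
      rw [negDigit, htl, hl] at this
      have h2 : (d i : ℝ) = (⌊β * (1 - t i)⌋ : ℝ) := by exact_mod_cast congrArg (fun z : ℤ => (z : ℝ)) this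
      rw [hsucc, Int.fract, h2]
  · rintro ⟨t, ht0, ht⟩
    have hfl : ∀ i, ⌊β * (1 - t i)⌋ = (d i : ℤ) := by
      intro i
      rw [Int.floor_eq_iff]
      obtain ⟨h1, h2, -⟩ := ht (i + 1)
      obtain ⟨-, -, h3⟩ := ht i
      push_cast
      constructor <;> linarith
    have htl : ∀ i, (T β)^[i] (leftEnd β) = leftEnd β + t i := by
      intro i
      induction i with
      | zero => simp [ht0]
      | succ i ih =>
        rw [Function.iterate_succ_apply', ih, hT, Int.fract, hfl, (ht i).2.2]
        push_cast
        ring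
    intro i
    rw [negDigit, htl, hl, hfl]

theorem isNegExpansion_iff {β : ℝ} (hβ : 1 < β) {d : ℕ → ℕ} :
    IsNegExpansion β (-β / (β + 1)) d ↔
      Bdd d ∧ val β d = 0 ∧ ∀ i, 0 ≤ val β (shift i d) ∧ val β (shift i d) < 1 := by
  have hβ0 : β ≠ 0 := by linarith
  rw [isNegExpansion_iff_orbit hβ]
  constructor
  · rintro ⟨t, ht0, ht⟩
    have hd : Bdd d := by
      refine ⟨⌈β⌉₊, fun i => ?_⟩
      obtain ⟨h1, h2, -⟩ := ht (i + 1)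
      obtain ⟨h4, -, h3⟩ := ht i
      have : (d i : ℝ) ≤ ⌈β⌉₊ := le_trans (by nlinarith) (Nat.le_ceil β)
      exact_mod_cast this
    have hv : ∀ i, val β (shift i d) = t i :=
      val_shift_eq hβ hd (K := 1) (fun i => abs_le.2 ⟨by linarith [(ht i).1], (ht i).2.1.le⟩)
        (fun i => by rw [(ht i).2.2]; field_simp; ring)
    refine ⟨hd, (hv 0).trans ht0, fun i => ?_⟩
    rw [hv]
    exact ⟨(ht i).1, (ht i).2.1⟩
  · rintro ⟨hd, h0, h⟩
    refine ⟨fun i => val β (shift i d), h0, fun i => ⟨(h i).1, (h i).2, ?_⟩⟩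
    have h := val_rec hβ (hd.shift i)
    rw [shift_shift, add_comm 1 i, show shift i d 0 = d i by simp [shift]] at h
    beta_reduce
    rw [h]
    field_simp
    ring

theorem exists_isNegExpansion {β : ℝ} (hβ : 1 < β) : ∃ a, IsNegExpansion β (-β / (β + 1)) a := by
  set t : ℕ → ℝ := fun i => (fun z => Int.fract (β * (1 - z)))^[i] 0 with ht
  have hrec : ∀ i, t (i + 1) = Int.fract (β * (1 - t i)) := fun i => by
    simp only [ht, Function.iterate_succ_apply']
  have h0 : ∀ i, 0 ≤ t i ∧ t i < 1 := by
    intro i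
    cases i with
    | zero => simp [ht]
    | succ i => rw [hrec]; exact ⟨Int.fract_nonneg _, Int.fract_lt_one _⟩
  refine ⟨fun i => ⌊β * (1 - t i)⌋₊, (isNegExpansion_iff_orbit hβ).2 ⟨t, by simp [ht], fun i =>
    ⟨(h0 i).1, (h0 i).2, ?_⟩⟩⟩
  have : (⌊β * (1 - t i)⌋₊ : ℝ) = (⌊β * (1 - t i)⌋ : ℝ) := by
    apply natCast_floor_eq_intCast_floor
    have := (h0 i).2
    nlinarith
  rw [hrec, Int.fract, this]

/-! ### Words coded by two blocks -/

/-- Among `pre a k` and `lowered a k`, the block of odd length. -/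
def oddBlock (a : ℕ → ℕ) (k : ℕ) : List ℕ := if Even k then lowered a k else pre a k

/-- Among `pre a k` and `lowered a k`, the block of even length. -/
def evenBlock (a : ℕ → ℕ) (k : ℕ) : List ℕ := if Even k then pre a k else lowered a k

/-- Every word of `S` is the concatenation of one of the blocks `v`, `w` and a word of `S`. -/
def IsCode (v w : List ℕ) (S : Set (ℕ → ℕ)) : Prop :=
  ∀ x ∈ S, ∃ y ∈ S, x = concat v y ∨ x = concat w y

theorem pre_eq_append {a : ℕ → ℕ} {k : ℕ} (hk : 0 < k) : pre a k = pre a (k - 1) ++ [a (k - 1)] := by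
  obtain ⟨m, rfl⟩ : ∃ m, k = m + 1 := ⟨k - 1, by omega⟩
  exact pre_succ a m

theorem length_lowered {a : ℕ → ℕ} {k : ℕ} (hk : 0 < k) : (lowered a k).length = k + 1 := by
  simp [lowered]; omega

theorem odd_length_oddBlock {a : ℕ → ℕ} {k : ℕ} (hk : 0 < k) : Odd (oddBlock a k).length := by
  rw [oddBlock]
  split_ifs with h
  · rw [length_lowered hk]; exact h.add_one
  · simpa using h

theorem even_length_evenBlock {a : ℕ → ℕ} {k : ℕ} (hk : 0 < k) : Even (evenBlock a k).length := by
  rw [evenBlock]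
  split_ifs with h
  · simpa using h
  · rw [length_lowered hk]; exact (Nat.not_even_iff_odd.1 h).add_one

theorem evenBlock_ne_nil {a : ℕ → ℕ} {k : ℕ} (hk : 0 < k) : evenBlock a k ≠ [] := by
  rw [evenBlock]
  split_ifs
  · rw [← List.length_pos_iff]; simpa using hk
  · rw [← List.length_pos_iff, length_lowered hk]; omega

theorem oddBlock_ne_nil {a : ℕ → ℕ} {k : ℕ} (hk : 0 < k) : oddBlock a k ≠ [] := by
  rw [← List.length_pos_iff]; exact (odd_length_oddBlock hk).pos

theorem maxWord_eq {a : ℕ → ℕ} {k : ℕ} (hk : 0 < k) (ha : Function.Periodic a k) :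
    maxWord a k = rep (evenBlock a k) := by
  rw [maxWord, evenBlock]
  split_ifs
  · rw [rep_pre hk ha]
  · rfl

theorem minWord_eq {a : ℕ → ℕ} {k : ℕ} (hk : 0 < k) (ha : Function.Periodic a k) :
    minWord a k = concat (oddBlock a k) (rep (evenBlock a k)) := by
  rw [minWord, evenBlock, oddBlock]
  split_ifs
  · rw [rep_pre hk ha]
  · rfl

/-- The blocks share `a₁⋯a_{k-1}` and differ at position `k`, where the larger letter `a_k` makes
`A` smaller for odd `k` and larger for even `k`. -/
theorem oddBlock_lt_evenBlock {a : ℕ → ℕ} {k : ℕ} (hk : 0 < k) (h : a (k - 1) ≠ 0) (x y : ℕ → ℕ) :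
    AltLT (concat (oddBlock a k) x) (concat (evenBlock a k) y) := by
  have key : ∀ x y, AltLT (concat [a (k - 1)] x) (concat [a (k - 1) - 1, 0] y) := by
    intro x y
    rw [altLT_iff]
    left
    simp
    omega
  rw [evenBlock, oddBlock]
  split_ifs with hev <;> rw [pre_eq_append hk, lowered, concat_append, concat_append]
  · refine ((concat_lt_concat _ _ _).2 ?_).2 (key _ _)
    rw [length_pre]
    exact Nat.Even.sub_odd hk hev odd_one
  · refine ((concat_lt_concat _ _ _).1 ?_).2 (key _ _)
    rw [length_pre]
    exact Nat.Odd.sub_odd (Nat.not_even_iff_odd.1 hev) odd_one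

theorem eq_concat_block_of_between {a : ℕ → ℕ} {k : ℕ} (hk : 0 < k) {x y z : ℕ → ℕ}
    (h1 : AltLE (concat (oddBlock a k) y) x) (h2 : AltLE x (concat (evenBlock a k) z)) :
    ∃ x', x = concat (oddBlock a k) x' ∨ x = concat (evenBlock a k) x' := by
  have key : ∀ x y z, AltLE (concat [a (k - 1)] y) x → AltLE x (concat [a (k - 1) - 1, 0] z) →
      (∃ x', x = concat [a (k - 1)] x') ∨ ∃ x', x = concat [a (k - 1) - 1, 0] x' := by
    intro x y z h1 h2
    have e1 := h1.head_le
    have e2 := h2.head_le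
    rw [concat_cons_zero] at e1 e2
    by_cases hx : x 0 = a (k - 1)
    · exact Or.inl ⟨shift 1 x, word_ext (by simpa using hx) (by simp)⟩
    · right
      have hx' : x 0 = a (k - 1) - 1 := by omega
      have h3 := (h2.tail (by rw [concat_cons_zero, hx'])).head_le
      rw [shift_one_concat_cons, concat_cons_zero] at h3
      refine ⟨shift 1 (shift 1 x), word_ext (by simpa using hx') (word_ext ?_ ?_)⟩
      · rw [shift_one_concat_cons, concat_cons_zero]; omega
      · simp
  rw [evenBlock, oddBlock] at *
  split_ifs at * with hev
  · rw [pre_eq_append hk, lowered, concat_append] at *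
    obtain ⟨x', rfl⟩ := eq_concat_of_between _ h1 h2
    have hodd : Odd (pre a (k - 1)).length := by
      rw [length_pre]; exact Nat.Even.sub_odd hk hev odd_one
    rw [(concat_le_concat _ _ _).2 hodd] at h2
    rw [(concat_le_concat _ _ _).2 hodd] at h1
    rcases key _ _ _ h2 h1 with ⟨x', rfl⟩ | ⟨x', rfl⟩
    · exact ⟨x', Or.inr (concat_append _ _ _).symm⟩
    · exact ⟨x', Or.inl (concat_append _ _ _).symm⟩
  · rw [pre_eq_append hk, lowered, concat_append] at *
    obtain ⟨x', rfl⟩ := eq_concat_of_between _ h1 h2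
    have heven : Even (pre a (k - 1)).length := by
      rw [length_pre]; exact Nat.Odd.sub_odd (Nat.not_even_iff_odd.1 hev) odd_one
    rw [(concat_le_concat _ _ _).1 heven] at h2
    rw [(concat_le_concat _ _ _).1 heven] at h1
    rcases key _ _ _ h1 h2 with ⟨x', rfl⟩ | ⟨x', rfl⟩
    · exact ⟨x', Or.inl (concat_append _ _ _).symm⟩
    · exact ⟨x', Or.inr (concat_append _ _ _).symm⟩

/-- With `O` and `E` the odd and even blocks, the bounds are `O E^∞` and `E^∞`. Words between them
begin with `O` or `E`, and stripping the block leaves a word at most `E^∞`: after `O` by the lower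
bound, whose order is reversed, and after `E` by the upper bound. -/
theorem isCode_of_between {a : ℕ → ℕ} {k : ℕ} (hk : 0 < k) (ha : Function.Periodic a k) :
    IsCode (oddBlock a k) (evenBlock a k)
      {x | AltLE x (maxWord a k) ∧ ∀ n, AltLE (minWord a k) (shift n x)} := by
  rintro x ⟨hmax, hmin⟩
  rw [maxWord_eq hk ha, ← concat_rep (evenBlock_ne_nil hk)] at hmax
  have h0 := hmin 0
  rw [minWord_eq hk ha, shift_zero] at h0
  have htail : ∀ w y, x = concat w y → ∀ n, AltLE (minWord a k) (shift n y) := by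
    rintro w y rfl n
    have := hmin (n + w.length)
    rwa [← shift_shift, shift_length_concat] at this
  obtain ⟨y, hy | hy⟩ := eq_concat_block_of_between hk h0 hmax
  · refine ⟨y, ⟨?_, htail _ y hy⟩, Or.inl hy⟩
    rw [hy, (concat_le_concat _ _ _).2 (odd_length_oddBlock hk)] at h0
    rwa [maxWord_eq hk ha]
  · refine ⟨y, ⟨?_, htail _ y hy⟩, Or.inr hy⟩
    rw [hy, (concat_le_concat _ _ _).1 (even_length_evenBlock hk)] at hmax
    rwa [maxWord_eq hk ha]

/-- If a coded word exceeded `E^∞`, its first block could not be `O`. Stripping an `E` keeps the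
parity and moves the first difference to the left. -/
theorem IsCode.le_maxWord {a : ℕ → ℕ} {k : ℕ} (hk : 0 < k) (ha : Function.Periodic a k)
    (h : a (k - 1) ≠ 0) {S : Set (ℕ → ℕ)} (hS : IsCode (oddBlock a k) (evenBlock a k) S)
    {x : ℕ → ℕ} (hx : x ∈ S) : AltLE x (maxWord a k) := by
  rw [maxWord_eq hk ha, ← not_altLT]
  rintro ⟨n, hn, hlt⟩
  have hE := evenBlock_ne_nil (a := a) hk
  have hl : 0 < (evenBlock a k).length := List.length_pos_iff.2 hE
  induction n using Nat.strong_induction_on generalizing x with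
  | _ n ih =>
    obtain ⟨y, hy, rfl | rfl⟩ := hS x hx
    · have h1 : AltLT (concat (evenBlock a k) (rep (evenBlock a k))) (concat (oddBlock a k) y) := by
        rw [concat_rep hE]; exact ⟨n, hn, hlt⟩
      exact altLT_irrefl _ (h1.trans (oddBlock_lt_evenBlock hk h _ _))
    · rw [← concat_rep hE] at hn hlt
      have hln : (evenBlock a k).length ≤ n := by
        by_contra! hcon
        simp [concat, hcon] at hlt
      obtain ⟨m, rfl⟩ := Nat.exists_eq_add_of_le hln
      refine ih m (by omega) hy ?_ ?_
      · intro i hi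
        have := hn ((evenBlock a k).length + i) (by omega)
        simpa [concat] using this
      · rw [show (evenBlock a k).length + m + 1 = (evenBlock a k).length + (m + 1) by ring, pow_add,
          (even_length_evenBlock hk).neg_one_pow, one_mul] at hlt
        simpa [concat] using hlt

theorem IsCode.minWord_le {a : ℕ → ℕ} {k : ℕ} (hk : 0 < k) (ha : Function.Periodic a k)
    (h : a (k - 1) ≠ 0) {S : Set (ℕ → ℕ)} (hS : IsCode (oddBlock a k) (evenBlock a k) S)
    {x : ℕ → ℕ} (hx : x ∈ S) : AltLE (minWord a k) x := by
  rw [minWord_eq hk ha]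
  obtain ⟨y, hy, rfl | rfl⟩ := hS x hx
  · rw [(concat_le_concat _ _ _).2 (odd_length_oddBlock hk), ← maxWord_eq hk ha]
    exact hS.le_maxWord hk ha h hy
  · exact (oddBlock_lt_evenBlock hk h _ _).le

theorem concat_pre_of_periodic {a : ℕ → ℕ} {k : ℕ} (ha : Function.Periodic a k) :
    concat (pre a k) a = a := by
  have h : shift k a = a := funext ha
  have := concat_pre_shift a k
  rwa [h] at this

theorem eq_concat_pre_or_lowered {a : ℕ → ℕ} {k : ℕ} {x y : ℕ → ℕ} :
    (x = concat (oddBlock a k) y ∨ x = concat (evenBlock a k) y) ↔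
      (x = concat (pre a k) y ∨ x = concat (lowered a k) y) := by
  rw [evenBlock, oddBlock]
  split_ifs <;> tauto

theorem isCode_singleton {a : ℕ → ℕ} {k : ℕ} (ha : Function.Periodic a k) :
    IsCode (oddBlock a k) (evenBlock a k) {a} := by
  rintro x rfl
  exact ⟨x, rfl, eq_concat_pre_or_lowered.2 (Or.inl (concat_pre_of_periodic ha).symm)⟩

theorem minWord_le_self {a : ℕ → ℕ} {k : ℕ} (hk : 0 < k) (ha : Function.Periodic a k)
    (h : a (k - 1) ≠ 0) : AltLE (minWord a k) a :=
  (isCode_singleton ha).minWord_le hk ha h rfl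

theorem IsCode.le_sum {v w : List ℕ} (hv : v ≠ []) (hw : w ≠ []) {S : Set (ℕ → ℕ)}
    (hS : IsCode v w S) {x : ℕ → ℕ} (hx : x ∈ S) (i : ℕ) : x i ≤ v.sum + w.sum := by
  have hlv : 0 < v.length := List.length_pos_iff.2 hv
  have hlw : 0 < w.length := List.length_pos_iff.2 hw
  have hle : ∀ (u : List ℕ) (i : ℕ), i < u.length → u.getD i 0 ≤ u.sum := by
    intro u i h
    rw [List.getD_eq_getElem _ _ h]
    exact List.single_le_sum (by simp) _ (List.getElem_mem h)
  induction i using Nat.strong_induction_on generalizing x with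
  | _ i ih =>
    obtain ⟨y, hy, rfl | rfl⟩ := hS x hx <;> simp only [concat] <;> split_ifs with h
    · exact (hle v i h).trans (by omega)
    · exact ih _ (by omega) hy
    · exact (hle w i h).trans (by omega)
    · exact ih _ (by omega) hy

/-- Before a word of value `0`, the letter `0` creates the value `1`, which makes up for the
lowering of `a_k` by one. -/
theorem val_concat_lowered {s : ℝ} (hs : 1 < s) {a : ℕ → ℕ} {k : ℕ} (hk : 0 < k)
    (h : a (k - 1) ≠ 0) {y : ℕ → ℕ} (hy : Bdd y) (hy0 : val s y = 0) :
    val s (concat (lowered a k) y) = val s (concat (pre a k) y) := by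
  rw [pre_eq_append hk, lowered, concat_append, concat_append, ← sub_eq_zero,
    val_concat_sub hs _ (hy.concat _) (hy.concat _)]
  have hs0 : s ≠ 0 := by linarith
  have e1 : val s (concat [a (k - 1)] y) = 1 - (a (k - 1) : ℝ) / s := by
    rw [val_rec hs (hy.concat _)]; simp [hy0]
  have e2 : val s (concat [a (k - 1) - 1, 0] y) = 1 - (a (k - 1) : ℝ) / s := by
    rw [val_rec hs (hy.concat _), shift_one_concat_cons, val_rec hs (hy.concat _),
      shift_one_concat_cons, concat_nil, hy0, concat_cons_zero, concat_cons_zero,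
      Nat.cast_sub (by omega)]
    simp
  rw [e1, e2]
  ring

/-- Prefixing either block maps value `0` to value `0` and contracts values by at least `1 / s`. -/
theorem IsCode.val_eq_zero {s : ℝ} (hs : 1 < s) {a : ℕ → ℕ} {k : ℕ} (hk : 0 < k)
    (ha : Function.Periodic a k) (h : a (k - 1) ≠ 0) (hab : Bdd a) (ha0 : val s a = 0)
    {S : Set (ℕ → ℕ)} (hS : IsCode (oddBlock a k) (evenBlock a k) S) :
    ∀ x ∈ S, val s x = 0 := by
  have hs0 : 0 < s := by linarith
  have hle := fun x (hx : x ∈ S) => hS.le_sum (oddBlock_ne_nil hk) (evenBlock_ne_nil hk) hx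
  have hA : val s (concat (pre a k) a) = 0 := by rw [concat_pre_of_periodic ha, ha0]
  have hB : val s (concat (lowered a k) a) = 0 := by rw [val_concat_lowered hs hk h hab ha0, hA]
  have hw : ∀ w : List ℕ, 0 < w.length → val s (concat w a) = 0 → ∀ y, Bdd y →
      |val s (concat w y)| ≤ (1 / s) * |val s y| := by
    intro w hw hw0 y hy
    have := val_concat_sub hs w hy hab
    rw [hw0, ha0, sub_zero, sub_zero] at this
    rw [this, abs_mul, abs_pow, abs_div, abs_neg, abs_one, abs_of_pos hs0]
    gcongr
    exact pow_le_of_le_one (by positivity) (by rw [div_le_one] <;> linarith) (by omega)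
  refine eq_zero_of_contraction (r := 1 / s) (by positivity) (by rw [div_lt_one] <;> linarith)
    (fun x hx => abs_val_le hs (hle x hx)) (fun x hx => ?_)
  obtain ⟨y, hy, hxy⟩ := hS x hx
  refine ⟨y, hy, ?_⟩
  have hyb : Bdd y := ⟨_, hle y hy⟩
  rcases eq_concat_pre_or_lowered.1 hxy with rfl | rfl
  · exact hw _ (by simpa using hk) hA y hyb
  · exact hw _ (by rw [length_lowered hk]; omega) hB y hyb

/-! ### Desubstituting words coded by two binary blocks -/

/-- The multiplicative weight of a binary word for which `0` has weight `b` and `1` has weight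
`b'`. -/
noncomputable def wt (b b' : ℝ) (w : List ℕ) : ℝ := (w.map fun j => if j = 0 then b else b').prod

theorem wt_append (b b' : ℝ) (w w' : List ℕ) : wt b b' (w ++ w') = wt b b' w * wt b b' w' := by
  simp [wt]

theorem wt_cons (b b' : ℝ) (j : ℕ) (w : List ℕ) :
    wt b b' (j :: w) = (if j = 0 then b else b') * wt b b' w := by
  simp [wt]

theorem wt_self (b : ℝ) (w : List ℕ) : wt b b w = b ^ w.length := by simp [wt]

theorem one_le_wt {b b' : ℝ} (hb : 1 ≤ b) (hb' : 1 ≤ b') (w : List ℕ) : 1 ≤ wt b b' w := by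
  induction w with
  | nil => simp [wt]
  | cons j w ih =>
    rw [wt_cons]
    split_ifs
    · exact one_le_mul_of_one_le_of_one_le hb ih
    · exact one_le_mul_of_one_le_of_one_le hb' ih

/-- The new weights of `0` and `1` after desubstitution are the old weights of `1` and `100`, so
block weights, and with them `BinaryCode.one_le`, are preserved. -/
theorem wt_phiL (b b' : ℝ) (w : List ℕ) : wt b b' (phiL w) = wt b' (b' * b ^ 2) w := by
  induction w with
  | nil => simp [wt, phiL]
  | cons j w ih =>
    have hL : phiL (j :: w) = (if j = 0 then [1] else [1, 0, 0]) ++ phiL w := by simp [phiL]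
    rw [hL, wt_append, ih, wt_cons]
    split_ifs
    · simp [wt]
    · have h100 : wt b b' [1, 0, 0] = b' * b ^ 2 := by simp [wt, pow_two]
      rw [h100]

theorem phiW_rep {w : List ℕ} (hw : w ≠ []) : phiW (rep w) = rep (phiL w) := by
  have hl := length_le_length_phiL w
  have hw' : phiL w ≠ [] := by
    rw [← List.length_pos_iff] at *; omega
  refine eq_rep_of_forall (S := {phiW (rep w)}) hw' ?_ rfl
  rintro x rfl
  exact ⟨_, rfl, by rw [← phiW_concat, concat_rep hw]⟩

theorem rep_binary {w : List ℕ} (hw : ∀ j ∈ w, j ≤ 1) : Binary (rep w) := by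
  intro i
  rw [rep]
  rcases Nat.lt_or_ge (i % w.length) w.length with h | h
  · rw [List.getD_eq_getElem _ _ h]; exact hw _ (List.getElem_mem h)
  · rw [List.getD_eq_default _ _ h]; omega

/-- Data for a binary alternate Lyndon word `d` with value zero and nonnegative tails, coded by the
blocks `u1` and `u00`. -/
structure BinaryCode (u : List ℕ) (Y : (ℕ → ℕ) → ℝ) (p b b' : ℝ) (d : ℕ → ℕ) (S : Set (ℕ → ℕ)) :
    Prop where
  weighted : IsWeighted Y p b b'
  p_pos : 0 < p
  one_lt : 1 < b
  le : b ≤ b'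
  binary : Binary d
  lyndon : IsAltLyndon d
  zero : Y d = 0
  nonneg : ∀ n, 0 ≤ Y (shift n d)
  mem : d ∈ S
  tails : ∀ x ∈ S, ∃ n, x = shift n d
  code : ∀ x ∈ S, ∃ y ∈ S, x = concat (u ++ [1]) y ∨ x = concat (u ++ [0, 0]) y
  occurs_one : ∃ x ∈ S, ∃ y ∈ S, x = concat (u ++ [1]) y
  occurs_zero : ∃ x ∈ S, ∃ y ∈ S, x = concat (u ++ [0, 0]) y
  one_le : 1 ≤ 1 / wt b b' (u ++ [1]) + 1 / wt b b' (u ++ [0, 0])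
  lt_phiInf : AltLT (rep (if Even u.length then u ++ [0, 0] else u ++ [1])) phiInf

section
variable {u : List ℕ} {Y : (ℕ → ℕ) → ℝ} {p b b' : ℝ} {d : ℕ → ℕ} {S : Set (ℕ → ℕ)}

theorem BinaryCode.tail_zero (h : BinaryCode u Y p b b' d S) {n : ℕ} (hn : d n = 0) :
    Y (shift n d) = p - Y (shift (n + 1) d) / b := by
  have := (h.weighted _ (h.binary.shift n)).1 (by simpa [shift] using hn)
  rwa [shift_shift, add_comm] at this

theorem BinaryCode.tail_one (h : BinaryCode u Y p b b' d S) {n : ℕ} (hn : d n = 1) :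
    Y (shift n d) = p * (1 - 1 / b) - Y (shift (n + 1) d) / b' := by
  have := (h.weighted _ (h.binary.shift n)).2 (by simpa [shift] using hn)
  rwa [shift_shift, add_comm] at this

theorem BinaryCode.tail_le_of_one (h : BinaryCode u Y p b b' d S) {n : ℕ} (hn : d n = 1) :
    Y (shift n d) ≤ p * (1 - 1 / b) := by
  rw [h.tail_one hn]
  have := div_nonneg (h.nonneg (n + 1)) (by linarith [h.one_lt, h.le] : 0 ≤ b')
  linarith

theorem BinaryCode.tail_le (h : BinaryCode u Y p b b' d S) (n : ℕ) : Y (shift n d) ≤ p := by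
  have h1 := h.one_lt
  have h2 := h.binary n
  have h3 := h.p_pos
  rcases Nat.le_one_iff_eq_zero_or_eq_one.1 h2 with hn | hn
  · rw [h.tail_zero hn]
    have := div_nonneg (h.nonneg (n + 1)) (by linarith : 0 ≤ b)
    linarith
  · refine (h.tail_le_of_one hn).trans ?_
    have : 0 ≤ 1 / b := by positivity
    nlinarith

theorem BinaryCode.head (h : BinaryCode u Y p b b' d S) : d 0 = 1 := by
  rcases Nat.le_one_iff_eq_zero_or_eq_one.1 (h.binary 0) with hn | hn
  · have h1 := h.tail_zero hn
    rw [shift_zero, h.zero] at h1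
    have h2 := h.tail_le 1
    have h3 := h.p_pos
    have h4 := h.one_lt
    have h5 : Y (shift (0 + 1) d) = p * b := by
      rw [show p = Y (shift (0 + 1) d) / b by linarith, div_mul_cancel₀]; linarith
    rw [zero_add] at h5
    nlinarith
  · exact hn

theorem BinaryCode.tail_first (h : BinaryCode u Y p b b' d S) :
    Y (shift 1 d) = p * (1 - 1 / b) * b' := by
  have h1 := h.tail_one h.head
  rw [shift_zero, h.zero] at h1
  rw [show p * (1 - 1 / b) = Y (shift (0 + 1) d) / b' by linarith, div_mul_cancel₀]
  linarith [h.one_lt, h.le]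

theorem BinaryCode.gap_pos (h : BinaryCode u Y p b b' d S) : 0 < p * (1 - 1 / b) := by
  apply mul_pos h.p_pos
  rw [sub_pos, div_lt_one] <;> linarith [h.one_lt]

/-- Value zero puts the first tail at `p(1 - 1/b)b'`, above the maximum `p(1 - 1/b)` for tails
starting with `1`. -/
theorem BinaryCode.second (h : BinaryCode u Y p b b' d S) : d 1 = 0 := by
  rcases Nat.le_one_iff_eq_zero_or_eq_one.1 (h.binary 1) with hn | hn
  · exact hn
  · have h1 := h.tail_le_of_one hn
    rw [h.tail_first] at h1
    nlinarith [h.gap_pos, h.one_lt, h.le]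

/-- An empty `u` or `u = 1` would make the even block `00` or `11`, whose repetition is not below
`φ^∞(1)`. A longer `u` contains the first two letters of `d`. -/
theorem BinaryCode.exists_eq_cons (h : BinaryCode u Y p b b' d S) : ∃ u', u = 1 :: 0 :: u' := by
  obtain ⟨y, -, hy⟩ := h.code d h.mem
  have h0 := h.head
  have h1 := h.second
  have hlt := h.lt_phiInf
  match u with
  | [] =>
    have := hlt.le.head_le
    simp [rep, phiInf_zero] at this
  | [j] =>
    have hj : j = 1 := by
      rcases hy with rfl | rfl <;> simpa [concat] using h0
    subst hj
    rw [altLT_iff, phiInf_zero] at hlt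
    rcases hlt with hlt | ⟨-, hlt⟩
    · simp [rep] at hlt
    · have := hlt.le.head_le
      rw [phiInf_eq] at this
      simp [rep, shift, concat] at this
  | j :: j' :: u' =>
    have hj : j = 1 := by
      rcases hy with rfl | rfl <;> simpa [concat] using h0
    have hj' : j' = 0 := by
      rcases hy with rfl | rfl <;> simpa [concat] using h1
    exact ⟨u', by rw [hj, hj']⟩

/-- If `d` began with `101`, the weight inequality would give `b'² ≤ b' + 1`, whereas the values
give `(b² - b)b' ≥ b² - b + 1` with `b² - b ≤ 1`, hence `b' ≥ 2`. -/
theorem BinaryCode.third (h : BinaryCode u Y p b b' d S) : d 2 = 0 := by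
  rcases Nat.le_one_iff_eq_zero_or_eq_one.1 (h.binary 2) with hn | hn
  · exact hn
  exfalso
  have hb := h.one_lt
  have hle := h.le
  have hp := h.p_pos
  have h1 := h.tail_zero h.second
  have h2 := h.tail_le_of_one hn
  rw [h.tail_first] at h1
  norm_num at h1
  obtain ⟨u', rfl⟩ := h.exists_eq_cons
  have hw := h.one_le
  have hu : 1 ≤ wt b b' u' := one_le_wt hb.le (hb.le.trans hle) u'
  have w1 : b' ^ 2 ≤ wt b b' (1 :: 0 :: u' ++ [1]) := by
    simp only [List.cons_append, wt_cons, wt_append, one_ne_zero, if_true, if_false]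
    rw [show wt b b' [] = 1 by simp [wt], mul_one,
      show b' * (b * (wt b b' u' * b')) = b' ^ 2 * (b * wt b b' u') by ring]
    exact le_mul_of_one_le_right (by positivity) (one_le_mul_of_one_le_of_one_le hb.le hu)
  have w2 : b' ≤ wt b b' (1 :: 0 :: u' ++ [0, 0]) := by
    simp only [List.cons_append, wt_cons, wt_append, one_ne_zero, if_true, if_false]
    rw [show wt b b' [] = 1 by simp [wt], mul_one]
    refine le_mul_of_one_le_right (by linarith) ?_
    exact one_le_mul_of_one_le_of_one_le hb.le (one_le_mul_of_one_le_of_one_le hu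
      (one_le_mul_of_one_le_of_one_le hb.le hb.le))
  have hb'0 : 0 < b' := by linarith
  have hw' : 1 ≤ 1 / b' ^ 2 + 1 / b' :=
    hw.trans (add_le_add (one_div_le_one_div_of_le (by positivity) w1)
      (one_div_le_one_div_of_le hb'0 w2))
  have hgold : b' ^ 2 ≤ b' + 1 := by
    have := mul_le_mul_of_nonneg_right hw' (by positivity : 0 ≤ b' ^ 2)
    have e : (1 / b' ^ 2 + 1 / b') * b' ^ 2 = 1 + b' := by field_simp
    rw [e] at this
    linarith
  have hmain : b ^ 2 - b + 1 ≤ (b ^ 2 - b) * b' := by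
    have h3 : p * (1 - 1 / b) * b' ≥ p - p * (1 - 1 / b) / b := by
      have : Y (shift 2 d) / b ≤ p * (1 - 1 / b) / b := by gcongr
      simp only [one_div] at this ⊢
      linarith
    have h4 := mul_le_mul_of_nonneg_right h3 (by positivity : 0 ≤ b ^ 2 / p)
    have e1 : (p - p * (1 - 1 / b) / b) * (b ^ 2 / p) = b ^ 2 - b + 1 := by field_simp; ring
    have e2 : p * (1 - 1 / b) * b' * (b ^ 2 / p) = (b ^ 2 - b) * b' := by field_simp
    linarith
  have ht : b ^ 2 - b ≤ 1 := by nlinarith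
  have ht0 : 0 < b ^ 2 - b := by nlinarith
  have : 2 ≤ b' := by nlinarith
  nlinarith

/-- If `d` began with `1000`, the values would give `b' b² ≥ b² + 1`, which makes both block weights
exceed `2`, against `BinaryCode.one_le`. -/
theorem BinaryCode.fourth (h : BinaryCode u Y p b b' d S) : d 3 = 1 := by
  rcases Nat.le_one_iff_eq_zero_or_eq_one.1 (h.binary 3) with hn | hn
  swap
  · exact hn
  exfalso
  have hb := h.one_lt
  have hle := h.le
  have hp := h.p_pos
  have h1 := h.tail_zero h.second
  have h2 := h.tail_zero h.third
  have h3 := h.tail_zero hn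
  have h4 := h.tail_le 4
  rw [h.tail_first] at h1
  norm_num at h1 h2 h3
  obtain ⟨u', rfl⟩ := h.exists_eq_cons
  have hw := h.one_le
  have hu : 1 ≤ wt b b' u' := one_le_wt hb.le (hb.le.trans hle) u'
  have hb'0 : 0 < b' := by linarith
  have w1 : b' ^ 2 * b ≤ wt b b' (1 :: 0 :: u' ++ [1]) := by
    simp only [List.cons_append, wt_cons, wt_append, one_ne_zero, if_true, if_false]
    rw [show wt b b' [] = 1 by simp [wt], mul_one,
      show b' * (b * (wt b b' u' * b')) = b' ^ 2 * b * wt b b' u' by ring]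
    exact le_mul_of_one_le_right (by positivity) hu
  have w2 : b' * b ^ 3 ≤ wt b b' (1 :: 0 :: u' ++ [0, 0]) := by
    simp only [List.cons_append, wt_cons, wt_append, one_ne_zero, if_true, if_false]
    rw [show wt b b' [] = 1 by simp [wt], mul_one,
      show b' * (b * (wt b b' u' * (b * b))) = b' * b ^ 3 * wt b b' u' by ring]
    exact le_mul_of_one_le_right (by positivity) hu
  have hmain : b ^ 2 + 1 ≤ b' * b ^ 2 := by
    have e3 : p - p / b ≤ Y (shift 3 d) := by
      rw [h3]
      gcongr
    have e2 : Y (shift 2 d) ≤ p - (p - p / b) / b := by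
      rw [h2]
      gcongr
    have e1 : p - (p - (p - p / b) / b) / b ≤ p * (1 - 1 / b) * b' := by
      rw [one_div, h1]
      gcongr
    have h5 := mul_le_mul_of_nonneg_right e1 (by positivity : 0 ≤ b ^ 3 / p)
    have f1 : (p - (p - (p - p / b) / b) / b) * (b ^ 3 / p) = (b - 1) * (b ^ 2 + 1) := by
      field_simp; ring
    have f2 : p * (1 - 1 / b) * b' * (b ^ 3 / p) = (b - 1) * (b' * b ^ 2) := by field_simp
    rw [f1, f2] at h5
    exact le_of_mul_le_mul_left h5 (by linarith)
  have g1 : 2 < b' ^ 2 * b := by nlinarith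
  have g2 : 2 < b' * b ^ 3 := by nlinarith
  have i1 : 1 / wt b b' (1 :: 0 :: u' ++ [1]) < 1 / 2 :=
    one_div_lt_one_div_of_lt (by norm_num) (g1.trans_le w1)
  have i2 : 1 / wt b b' (1 :: 0 :: u' ++ [0, 0]) < 1 / 2 :=
    one_div_lt_one_div_of_lt (by norm_num) (g2.trans_le w2)
  linarith

/-- Since `d` begins with `1001` it is an image, and so are the coded tails. The blocks are `u1 =
φ(w00)` and `u00 = φ(w1)`, so their roles are exchanged and `w` is shorter than `u`. -/
theorem BinaryCode.step (h : BinaryCode u Y p b b' d S) :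
    ∃ w e S', w.length < u.length ∧
      BinaryCode w (fun x => Y (phiW x)) (p * (1 - 1 / b)) b' (b' * b ^ 2) e S' := by
  have hb := h.one_lt
  have hle := h.le
  have hd4 : concat [1, 0, 0, 1] (shift 4 d) = d := by
    conv_rhs => rw [← concat_pre_shift d 4]
    simp [pre, List.range_succ, h.head, h.second, h.third, h.fourth]
  obtain ⟨e, he, hel, hde⟩ := exists_eq_phiW_of_lyndon h.binary h.lyndon h.head (Or.inl hd4)
  obtain ⟨u', hu'⟩ := h.exists_eq_cons
  have hhead : ∀ x ∈ S, x 0 = 1 := by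
    intro x hx
    obtain ⟨y, -, rfl | rfl⟩ := h.code x hx <;> simp [hu']
  set S' : Set (ℕ → ℕ) := {z | (∃ n, z = shift n e) ∧ phiW z ∈ S} with hS'
  have hbin : ∀ z ∈ S', Binary z := by
    rintro z ⟨⟨n, rfl⟩, -⟩
    exact he.shift n
  have hlift : ∀ x ∈ S, ∃ z ∈ S', x = phiW z := by
    intro x hx
    obtain ⟨n, hn⟩ := h.tails x hx
    have hx0 := hhead x hx
    rw [hn, hde] at hx0
    obtain ⟨m, -, hm⟩ := exists_shift_phiW (x := e) (n := n) (by simpa [shift] using hx0)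
    rw [← hde, ← hn] at hm
    exact ⟨shift m e, ⟨⟨m, rfl⟩, hm ▸ hx⟩, hm⟩
  -- An occurrence of `u00` is followed by a `1`, hence ends at a block boundary of `φ`; its last
  -- block must be `100`.
  obtain ⟨w, hw, hwb⟩ : ∃ w, u = phiL w ++ [1] ∧ ∀ j ∈ w, j ≤ 1 := by
    obtain ⟨x, hx, y, hy, hxy⟩ := h.occurs_zero
    obtain ⟨z, hz, hxz⟩ := hlift x hx
    have hzb := hbin z hz
    have h1 : shift (u ++ [0, 0]).length (phiW z) = y := by
      rw [← hxz, hxy, shift_length_concat]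
    have h2 : phiW z (u ++ [0, 0]).length = 1 := by
      have := hhead y hy
      rw [← h1] at this
      simpa [shift] using this
    obtain ⟨m, hm, -⟩ := exists_shift_phiW h2
    have h3 : phiL (pre z m) = u ++ [0, 0] := by
      have e1 : pre (phiW z) (phiL (pre z m)).length = phiL (pre z m) := by
        conv_lhs => rw [← concat_pre_shift z m, phiW_concat]
        rw [concat_pre_shift, pre_concat_length]
      rw [← e1, hm, ← hxz, hxy, pre_concat_length]
    cases m with
    | zero => simp [pre, phiL] at h3
    | succ m =>
      rw [pre_succ, phiL_append] at h3
      have h4 : phiL [z m] = if z m = 0 then [1] else [1, 0, 0] := by simp [phiL]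
      rw [h4] at h3
      split_ifs at h3
      · have := congrArg List.getLast? h3
        simp at this
      · refine ⟨pre z m, ?_, ?_⟩
        · have : (phiL (pre z m) ++ [1]) ++ [0, 0] = u ++ [0, 0] := by simpa using h3
          exact (List.append_cancel_right this).symm
        · intro j hj
          simp only [pre, List.mem_map] at hj
          obtain ⟨i, -, rfl⟩ := hj
          exact hzb i
  have hu1 : u ++ [1] = phiL (w ++ [0, 0]) := by rw [hw, phiL_append]; simp [phiL]
  have hu0 : u ++ [0, 0] = phiL (w ++ [1]) := by rw [hw, phiL_append]; simp [phiL]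
  have hbc : ∀ v : List ℕ, (∀ j ∈ v, j ≤ 1) → ∀ z, Binary z → Binary (concat v z) := by
    intro v hv z hz i
    simp only [concat]
    split_ifs with hi
    · rw [List.getD_eq_getElem _ _ hi]; exact hv _ (List.getElem_mem hi)
    · exact hz _
  have hw00 : ∀ j ∈ w ++ [0, 0], j ≤ 1 := by
    intro j hj
    simp only [List.mem_append, List.mem_cons, List.not_mem_nil, or_false, or_self] at hj
    rcases hj with hj | hj
    · exact hwb j hj
    · omega
  have hw1 : ∀ j ∈ w ++ [1], j ≤ 1 := by
    intro j hj
    simp only [List.mem_append, List.mem_cons, List.not_mem_nil, or_false] at hj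
    rcases hj with hj | hj
    · exact hwb j hj
    · omega
  have hone : ∀ z ∈ S', ∀ y ∈ S, phiW z = concat (u ++ [1]) y →
      ∃ z' ∈ S', z = concat (w ++ [0, 0]) z' := by
    intro z hz y hy hzy
    obtain ⟨z', hz', rfl⟩ := hlift y hy
    refine ⟨z', hz', phiW_injective (hbin z hz) (hbc _ hw00 _ (hbin z' hz')) ?_⟩
    rw [hzy, hu1, phiW_concat]
  have hzero : ∀ z ∈ S', ∀ y ∈ S, phiW z = concat (u ++ [0, 0]) y →
      ∃ z' ∈ S', z = concat (w ++ [1]) z' := by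
    intro z hz y hy hzy
    obtain ⟨z', hz', rfl⟩ := hlift y hy
    refine ⟨z', hz', phiW_injective (hbin z hz) (hbc _ hw1 _ (hbin z' hz')) ?_⟩
    rw [hzy, hu0, phiW_concat]
  refine ⟨w, e, S', ?_, h.weighted.phiW (by linarith) (by linarith), h.gap_pos, by linarith, ?_, he,
    hel, hde ▸ h.zero, fun n => ?_, ⟨⟨0, rfl⟩, hde ▸ h.mem⟩, fun x hx => hx.1, ?_, ?_, ?_, ?_, ?_⟩
  · have := length_le_length_phiL w
    rw [hw, List.length_append]
    simp
    omega
  · exact le_mul_of_one_le_right (by linarith) (one_le_pow₀ hb.le)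
  · rw [← shift_phiW, ← hde]
    exact h.nonneg _
  · intro z hz
    obtain ⟨y, hy, hzy | hzy⟩ := h.code _ hz.2
    · obtain ⟨z', hz', h'⟩ := hone z hz y hy hzy
      exact ⟨z', hz', Or.inr h'⟩
    · obtain ⟨z', hz', h'⟩ := hzero z hz y hy hzy
      exact ⟨z', hz', Or.inl h'⟩
  · obtain ⟨x, hx, y, hy, hxy⟩ := h.occurs_zero
    obtain ⟨z, hz, rfl⟩ := hlift x hx
    exact ⟨z, hz, hzero z hz y hy hxy⟩
  · obtain ⟨x, hx, y, hy, hxy⟩ := h.occurs_one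
    obtain ⟨z, hz, rfl⟩ := hlift x hx
    exact ⟨z, hz, hone z hz y hy hxy⟩
  · rw [← wt_phiL, ← wt_phiL, ← hu1, ← hu0, add_comm]
    exact h.one_le
  · have hpar : Even u.length ↔ ¬ Even w.length := by
      rw [hw, List.length_append, List.length_singleton, Nat.even_add_one, even_length_phiL]
    have hlt := h.lt_phiInf
    split_ifs with hev
    · rw [if_neg (by tauto), hu1, ← phiW_rep (by simp), ← phiW_phiInf,
        phiW_lt_iff (rep_binary hw00) phiInf_binary] at hlt
      exact hlt
    · rw [if_pos (by tauto), hu0, ← phiW_rep (by simp), ← phiW_phiInf,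
        phiW_lt_iff (rep_binary hw1) phiInf_binary] at hlt
      exact hlt

end

theorem not_binaryCode (u : List ℕ) (Y : (ℕ → ℕ) → ℝ) (p b b' : ℝ) (d : ℕ → ℕ) (S : Set (ℕ → ℕ)) :
    ¬ BinaryCode u Y p b b' d S := by
  induction hn : u.length using Nat.strong_induction_on generalizing u Y p b b' d S with
  | _ n ih =>
    intro h
    obtain ⟨w, e, S', hlt, h'⟩ := h.step
    exact ih _ (hn ▸ hlt) w _ _ _ _ e S' rfl h'

/-! ### Necessity of the conditions -/

/-- A difference of at least one in the first letter outweighs any difference of tail values in `[0,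
1)`. -/
theorem val_lt_val {s : ℝ} (hs : 1 < s) {x y : ℕ → ℕ} (hx : Bdd x) (hy : Bdd y)
    (hx1 : ∀ i, 0 ≤ val s (shift i x) ∧ val s (shift i x) < 1)
    (hy1 : ∀ i, 0 ≤ val s (shift i y) ∧ val s (shift i y) < 1) (h : AltLT x y) :
    val s x < val s y := by
  refine AltLT.induct (P := fun x y => Bdd x → Bdd y →
    (∀ i, 0 ≤ val s (shift i x) ∧ val s (shift i x) < 1) →
    (∀ i, 0 ≤ val s (shift i y) ∧ val s (shift i y) < 1) → val s x < val s y) ?_ ?_ h hx hy hx1 hy1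
  · intro x y hxy hx hy hx1 hy1
    rw [val_rec hs hx, val_rec hs hy]
    have h1 := (hx1 1).1
    have h2 := (hy1 1).2
    have h3 : (y 0 : ℝ) + 1 ≤ x 0 := by exact_mod_cast hxy
    have h4 : ((y 0 : ℝ) + val s (shift 1 y)) / s < ((x 0 : ℝ) + val s (shift 1 x)) / s := by
      apply div_lt_div_of_pos_right _ (by linarith)
      linarith
    linarith
  · intro x y h0 _ ih hx hy hx1 hy1
    have ih := ih (hy.shift 1) (hx.shift 1) (fun i => by rw [shift_shift]; exact hy1 _)
      (fun i => by rw [shift_shift]; exact hx1 _)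
    rw [val_rec hs hx, val_rec hs hy, h0]
    have h4 : ((y 0 : ℝ) + val s (shift 1 y)) / s < ((y 0 : ℝ) + val s (shift 1 x)) / s := by
      apply div_lt_div_of_pos_right _ (by linarith)
      linarith
    linarith

theorem lyndon_of_isNegExpansion {β : ℝ} (hβ : 1 < β) {d : ℕ → ℕ}
    (h : IsNegExpansion β (-β / (β + 1)) d) : IsAltLyndon d := by
  obtain ⟨hb, h0, h1⟩ := (isNegExpansion_iff hβ).1 h
  intro n
  rw [← not_altLT]
  intro hlt
  have := val_lt_val hβ (hb.shift n) hb (fun i => by rw [shift_shift]; exact h1 _) h1 hlt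
  linarith [(h1 n).1]

theorem val_ne_zero_of_preceded {β : ℝ} (hβ : 1 < β) {d : ℕ → ℕ} (hb : Bdd d)
    (h1 : ∀ i, 0 ≤ val β (shift i d) ∧ val β (shift i d) < 1) {n : ℕ} (hn : d n = 0) :
    val β (shift (n + 1) d) ≠ 0 := by
  intro h
  have := val_rec hβ (hb.shift n)
  rw [shift_shift, add_comm 1 n, h, show shift n d 0 = 0 by simpa [shift] using hn, Nat.cast_zero,
    add_zero, zero_div, sub_zero] at this
  linarith [(h1 n).2]

/-- Otherwise some `d n = 0` is followed by a tail at most `d*`. That tail equals `d`, or lies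
between `minWord` and `maxWord` of `d` and is coded by the two blocks; either way its value is `0`.
-/
theorem shift_lt_of_isNegExpansion {β : ℝ} (hβ : 1 < β) {d : ℕ → ℕ}
    (h : IsNegExpansion β (-β / (β + 1)) d) (n : ℕ) :
    AltLT (shift n d) (concat [0] (dStar d)) := by
  have hlyn := lyndon_of_isNegExpansion hβ h
  obtain ⟨hb, h0, h1⟩ := (isNegExpansion_iff hβ).1 h
  by_contra hlt
  rw [not_altLT] at hlt
  have hhead := hlt.head_le
  rw [concat_cons_zero, Nat.le_zero] at hhead
  have hn : d n = 0 := by simpa [shift] using hhead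
  have htail := hlt.tail (by rw [concat_cons_zero, hhead])
  rw [shift_one_concat_cons, concat_nil, shift_shift, add_comm 1 n] at htail
  apply val_ne_zero_of_preceded hβ hb h1 hn
  rw [dStar] at htail
  split_ifs at htail with hex
  · obtain ⟨hmin, hodd, hne⟩ := hex.choose_spec
    set k := hex.choose
    obtain ⟨⟨hk, hper⟩, -⟩ := hmin
    have hmax : rep (lowered d k) = maxWord d k := by
      rw [maxWord, if_neg (Nat.not_even_iff_odd.2 hodd)]
    rw [hmax] at htail
    refine (isCode_of_between hk hper).val_eq_zero hβ hk hper hne hb h0 _ ⟨htail, fun m => ?_⟩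
    rw [shift_shift]
    exact (minWord_le_self hk hper hne).trans (hlyn _)
  · rw [htail.antisymm (hlyn _), h0]

/-- Put `P = β ^ v.length` and `Q = β ^ w.length`. The blocks act on values by `t ↦ c - t/P` and `t
↦ c + t/Q`. Nonnegativity forces `c > 0`; then `d` starts with `v`, the rest has value `cP > c`, and
so it starts with `w`. -/
theorem exists_blocks_of_gap {β : ℝ} (hβ : 1 < β) {v w : List ℕ} (hv : Odd v.length)
    (hw : Even w.length) (hw0 : w ≠ []) {d : ℕ → ℕ} {S : Set (ℕ → ℕ)} (hS : IsCode v w S)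
    (hd : d ∈ S) (hSb : ∀ x ∈ S, Bdd x ∧ 0 ≤ val β x) (hd0 : val β d = 0) {c : ℝ}
    (hv1 : val β (concat v d) = c) (hw1 : val β (concat w d) = c) (hc : c ≠ 0) :
    (∃ x ∈ S, ∃ y ∈ S, x = concat v y) ∧ (∃ x ∈ S, ∃ y ∈ S, x = concat w y) ∧
      1 ≤ 1 / β ^ v.length + 1 / β ^ w.length := by
  have hβ0 : 0 < β := by linarith
  have hdb := (hSb d hd).1
  have hbound : ∀ x ∈ S, |val β x| ≤ ∑' i : ℕ, (1 / β) ^ i * (1 + ((v.sum + w.sum : ℕ) : ℝ)) := by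
    intro x hx
    refine abs_val_le hβ fun i => hS.le_sum ?_ hw0 hx i
    rw [← List.length_pos_iff]; exact hv.pos
  have hV : ∀ y, Bdd y → val β (concat v y) = c - val β y / β ^ v.length := by
    intro y hy
    have := val_concat_sub hβ v hy hdb
    rw [hv1, hd0, neg_div, hv.neg_pow, div_pow, one_pow] at this
    rw [div_eq_mul_one_div]
    linarith
  have hW : ∀ y, Bdd y → val β (concat w y) = c + val β y / β ^ w.length := by
    intro y hy
    have := val_concat_sub hβ w hy hdb
    rw [hw1, hd0, neg_div, hw.neg_pow, div_pow, one_pow] at this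
    rw [div_eq_mul_one_div]
    linarith
  set P := β ^ v.length with hP
  set Q := β ^ w.length with hQ
  have hP1 : 1 < P := one_lt_pow₀ hβ (by have := hv.pos; omega)
  have hQ1 : 1 < Q := one_lt_pow₀ hβ (by have := List.length_pos_iff.2 hw0; omega)
  have hr1 : 1 / Q < 1 := by rw [div_lt_one] <;> linarith
  have hr0 : 0 ≤ 1 / Q := by positivity
  have hc0 : 0 < c := by
    by_contra! hcle
    have hclt : c < 0 := lt_of_le_of_ne hcle hc
    have hall : ∀ x ∈ S, val β x = 0 := by
      refine eq_zero_of_contraction hr0 hr1 hbound fun x hx => ?_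
      obtain ⟨y, hy, rfl | rfl⟩ := hS x hx
      · have h1 := hV y (hSb y hy).1
        have h2 := (hSb _ hx).2
        have h3 := div_nonneg (hSb y hy).2 (by linarith : 0 ≤ P)
        linarith
      · refine ⟨y, hy, ?_⟩
        have h1 := hW y (hSb y hy).1
        rw [abs_of_nonneg (hSb _ hx).2, abs_of_nonneg (hSb y hy).2, h1]
        rw [one_div, inv_mul_eq_div]
        linarith
    obtain ⟨y, hy, hxy⟩ := hS d hd
    rcases hxy with hxy | hxy
    · have h1 := hV y (hSb y hy).1
      rw [← hxy, hall y hy, hd0] at h1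
      simp at h1
      linarith
    · have h1 := hW y (hSb y hy).1
      rw [← hxy, hall y hy, hd0] at h1
      simp at h1
      linarith
  obtain ⟨y, hy, hxy⟩ := hS d hd
  have hdv : d = concat v y := by
    rcases hxy with hxy | hxy
    · exact hxy
    · have h1 := hW y (hSb y hy).1
      rw [← hxy, hd0] at h1
      have h3 := div_nonneg (hSb y hy).2 (by linarith : 0 ≤ Q)
      linarith
  have hyval : val β y = c * P := by
    have h1 := hV y (hSb y hy).1
    rw [← hdv, hd0] at h1
    rw [show c = val β y / P by linarith, div_mul_cancel₀]
    linarith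
  have hlarge : ∀ x ∈ S, c < val β x → ∃ z ∈ S, x = concat w z := by
    intro x hx hcx
    obtain ⟨z, hz, rfl | rfl⟩ := hS x hx
    · have h1 := hV z (hSb z hz).1
      have h3 := div_nonneg (hSb z hz).2 (by linarith : 0 ≤ P)
      linarith
    · exact ⟨z, hz, rfl⟩
  obtain ⟨z, hz, hyz⟩ := hlarge y hy (by rw [hyval]; nlinarith)
  refine ⟨⟨d, hd, y, hy, hdv⟩, ⟨y, hy, z, hz, hyz⟩, ?_⟩
  by_contra! hcon
  have hcon' : P + Q < P * Q := by
    have := mul_lt_mul_of_pos_right hcon (by positivity : 0 < P * Q)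
    have e : (1 / P + 1 / Q) * (P * Q) = P + Q := by field_simp; ring
    linarith
  -- The fixed point of `t ↦ c + t/Q`. If `1/P + 1/Q < 1` then `cP > r`; from there only `w` can be
  -- stripped, and each time the distance to `r` grows by the factor `Q`, against boundedness.
  set r := c * Q / (Q - 1) with hr
  have hrQ : r * (Q - 1) = c * Q := by rw [hr, div_mul_cancel₀]; linarith
  have hrc : c < r := by nlinarith
  have hry : r < val β y := by
    rw [hyval]
    have : r * (Q - 1) < c * P * (Q - 1) := by rw [hrQ]; nlinarith
    exact lt_of_mul_lt_mul_right this (by linarith)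
  have hfix := eq_zero_of_contraction (S := {x | x ∈ S ∧ r < val β x}) (f := fun x => val β x - r)
    (K := (∑' i : ℕ, (1 / β) ^ i * (1 + ((v.sum + w.sum : ℕ) : ℝ))) + |r|) hr0 hr1
    (fun x hx => (abs_sub _ _).trans (add_le_add (hbound x hx.1) le_rfl)) ?_ y ⟨hy, hry⟩
  · linarith
  · rintro x ⟨hx, hxr⟩
    obtain ⟨z, hz, rfl⟩ := hlarge x hx (hrc.trans hxr)
    have h1 := hW z (hSb z hz).1
    have h2 : val β (concat w z) - r = 1 / Q * (val β z - r) := by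
      rw [h1]
      field_simp
      linarith
    refine ⟨z, ⟨hz, ?_⟩, ?_⟩
    · by_contra! hle
      have : 1 / Q * (val β z - r) ≤ 0 := mul_nonpos_of_nonneg_of_nonpos hr0 (by linarith)
      linarith
    · rw [h2, abs_mul, abs_of_nonneg hr0]

theorem not_mem_lyn_of_isNegExpansion {β : ℝ} (hβ : 1 < β) {d : ℕ → ℕ}
    (h : IsNegExpansion β (-β / (β + 1)) d) : d ∉ Lyn := by
  rintro ⟨hlyn, a, k, -, ⟨⟨hk, hper⟩, -⟩, hne, hda, hmin, hmax, hinf⟩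
  obtain ⟨hb, h0, h1⟩ := (isNegExpansion_iff hβ).1 h
  have hS0 := isCode_of_between hk hper
  set S : Set (ℕ → ℕ) := {x | (AltLE x (maxWord a k) ∧ ∀ n, AltLE (minWord a k) (shift n x)) ∧
    ∃ n, x = shift n d} with hSdef
  have hS : IsCode (oddBlock a k) (evenBlock a k) S := by
    rintro x ⟨hx, n, rfl⟩
    obtain ⟨y, hy, hxy⟩ := hS0 _ hx
    refine ⟨y, ⟨hy, ?_⟩, hxy⟩
    rcases hxy with hxy | hxy
    · exact ⟨_, by rw [← shift_shift, hxy, shift_length_concat]⟩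
    · exact ⟨_, by rw [← shift_shift, hxy, shift_length_concat]⟩
  have hdS : d ∈ S := ⟨⟨hmax, fun n => hmin.trans (hlyn n)⟩, 0, rfl⟩
  have hSb : ∀ x ∈ S, Bdd x ∧ 0 ≤ val β x := by
    rintro x ⟨-, n, rfl⟩
    exact ⟨hb.shift n, (h1 n).1⟩
  have hAB := val_concat_lowered hβ hk hne hb h0
  set c := val β (concat (pre a k) d) with hc
  have hv1 : val β (concat (oddBlock a k) d) = c := by
    rw [oddBlock]; split_ifs
    · exact hAB
    · rfl
  have hw1 : val β (concat (evenBlock a k) d) = c := by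
    rw [evenBlock]; split_ifs
    · rfl
    · exact hAB
  by_cases hc0 : c = 0
  · -- all words of the code have value zero, so the lowered block cannot occur
    have hcontr : ∀ v : List ℕ, v ≠ [] → val β (concat v d) = 0 → ∀ y, Bdd y →
        |val β (concat v y)| ≤ 1 / β * |val β y| := by
      intro v hv hv0 y hy
      have := val_concat_sub hβ v hy hb
      rw [hv0, h0, sub_zero, sub_zero] at this
      rw [this, abs_mul, abs_pow, abs_div, abs_neg, abs_one, abs_of_pos (by linarith : 0 < β)]
      gcongr
      have := List.length_pos_iff.2 hv
      exact pow_le_of_le_one (by positivity) (by rw [div_le_one] <;> linarith) (by omega)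
    have hall : ∀ x ∈ S, val β x = 0 := by
      refine eq_zero_of_contraction (r := 1 / β) (by positivity)
        (by rw [div_lt_one] <;> linarith)
        (fun x hx => abs_val_le hβ (hS.le_sum (oddBlock_ne_nil hk) (evenBlock_ne_nil hk) hx))
        (fun x hx => ?_)
      obtain ⟨y, hy, rfl | rfl⟩ := hS x hx
      · exact ⟨y, hy, hcontr _ (oddBlock_ne_nil hk) (hv1.trans hc0) y (hSb y hy).1⟩
      · exact ⟨y, hy, hcontr _ (evenBlock_ne_nil hk) (hw1.trans hc0) y (hSb y hy).1⟩
    have hA : ∀ x ∈ S, ∃ y ∈ S, x = concat (pre a k) y := by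
      intro x hx
      obtain ⟨y, hy, hxy⟩ := hS x hx
      refine ⟨y, hy, (eq_concat_pre_or_lowered.1 hxy).resolve_right fun hlow => ?_⟩
      obtain ⟨-, n, hn⟩ := hx
      have hk1 : d (n + k) = 0 := by
        have e : shift n d k = 0 := by
          have hsplit : lowered a k = (pre a (k - 1) ++ [a (k - 1) - 1]) ++ [0] := by simp [lowered]
          have hlen : (pre a (k - 1) ++ [a (k - 1) - 1]).length = k := by simp; omega
          have := congrFun (shift_length_concat (pre a (k - 1) ++ [a (k - 1) - 1]) (concat [0] y)) 0
          rw [← concat_append, ← hsplit, hlen, ← hlow, hn] at this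
          simpa [shift] using this
        rw [shift, add_comm] at e
        exact e
      apply val_ne_zero_of_preceded hβ hb h1 hk1
      have : shift (n + k + 1) d = y := by
        rw [show n + k + 1 = (lowered a k).length + n by rw [length_lowered hk]; ring, ← shift_shift,
          ← hn, hlow, shift_length_concat]
      rw [this, hall y hy]
    apply hda
    rw [← rep_pre hk hper]
    refine eq_rep_of_forall ?_ hA hdS
    rw [← List.length_pos_iff]; simpa using hk
  · obtain ⟨hoO, hoE, hle⟩ := exists_blocks_of_gap hβ (odd_length_oddBlock hk)
      (even_length_evenBlock hk) (evenBlock_ne_nil hk) hS hdS hSb h0 hv1 hw1 hc0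
    have hoccA : ∃ x ∈ S, ∃ y ∈ S, x = concat (pre a k) y := by
      rw [oddBlock] at hoO
      rw [evenBlock] at hoE
      split_ifs at hoO hoE
      · exact hoE
      · exact hoO
    have hoccB : ∃ x ∈ S, ∃ y ∈ S, x = concat (lowered a k) y := by
      rw [oddBlock] at hoO
      rw [evenBlock] at hoE
      split_ifs at hoO hoE
      · exact hoO
      · exact hoE
    have hle' : 1 ≤ 1 / β ^ k + 1 / β ^ (k + 1) := by
      rw [oddBlock, evenBlock] at hle
      split_ifs at hle
      · rw [length_lowered hk, length_pre] at hle; linarith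
      · rw [length_lowered hk, length_pre] at hle; linarith
    -- For `β ≥ 2` the two terms would sum to at most `1/2 + 1/4`.
    have hβ2 : β < 2 := by
      by_contra! hcon
      have e1 : 2 ^ 1 ≤ β ^ k := (pow_le_pow_left₀ (by norm_num) hcon 1).trans
        (pow_le_pow_right₀ hβ.le hk)
      have e2 : 2 ^ 2 ≤ β ^ (k + 1) := (pow_le_pow_left₀ (by norm_num) hcon 2).trans
        (pow_le_pow_right₀ hβ.le (by omega))
      have i1 : 1 / β ^ k ≤ 1 / 2 ^ 1 := one_div_le_one_div_of_le (by norm_num) e1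
      have i2 : 1 / β ^ (k + 1) ≤ 1 / 2 ^ 2 := one_div_le_one_div_of_le (by norm_num) e2
      norm_num at i1 i2 hle'
      linarith
    have hbin : Binary d := by
      intro i
      refine (hlyn.le_head i).trans ?_
      have e := val_rec hβ hb
      rw [h0] at e
      have e1 := (h1 1).1
      have e2 : ((d 0 : ℝ) + val β (shift 1 d)) = β := by
        have : ((d 0 : ℝ) + val β (shift 1 d)) / β = 1 := by linarith
        rwa [div_eq_one_iff_eq (by linarith)] at this
      have : (d 0 : ℝ) < 2 := by linarith
      have : d 0 < 2 := by exact_mod_cast this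
      omega
    have hdig : a (k - 1) = 1 := by
      obtain ⟨x, ⟨-, n, rfl⟩, y, -, hxy⟩ := hoccA
      have := hbin.shift n (k - 1)
      rw [hxy] at this
      simp [concat, pre, List.getD, hk] at this
      omega
    have hpre : pre a k = pre a (k - 1) ++ [1] := by rw [pre_eq_append hk, hdig]
    have hlow : lowered a k = pre a (k - 1) ++ [0, 0] := by rw [lowered, hdig]
    refine not_binaryCode (pre a (k - 1)) (val β) 1 β β d S
      ⟨isWeighted_val hβ, one_pos, hβ, le_rfl, hbin, hlyn, h0, fun n => (h1 n).1, hdS,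
        fun x hx => hx.2, fun x hx => ?_, ?_, ?_, ?_, ?_⟩
    · obtain ⟨y, hy, hxy⟩ := hS x hx
      rw [eq_concat_pre_or_lowered, hpre, hlow] at hxy
      exact ⟨y, hy, hxy⟩
    · rwa [← hpre]
    · rwa [← hlow]
    · rw [wt_self, wt_self, ← hpre, ← hlow, length_pre, length_lowered hk]
      exact hle'
    · rw [maxWord_eq hk hper, evenBlock, hpre, hlow] at hinf
      rw [length_pre]
      have hpar : Even (k - 1) ↔ ¬ Even k := by
        obtain ⟨m, rfl⟩ : ∃ m, k = m + 1 := ⟨k - 1, by omega⟩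
        rw [Nat.even_add_one, not_not, Nat.add_sub_cancel]
      split_ifs at hinf with hev
      · rw [if_neg (by tauto)]; exact hinf
      · rw [if_pos (by tauto)]; exact hinf

/-! ### Counting the words all of whose tails are at least `d` -/

/-- The pair of `num d n` and `cum d n`. -/
def numCum (d : ℕ → ℕ) : ℕ → ℤ × ((ℕ → ℕ) → ℤ)
  | 0 => (1, fun _ => 0)
  | n + 1 =>
    (d 0 * (numCum d n).1 + (numCum d n).2 (shift 1 d) + 1,
      fun x => d 0 * (numCum d n).1 + (numCum d n).2 (shift 1 d) - x 0 * (numCum d n).1 -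
        (numCum d n).2 (shift 1 x))

/-- The number of words of length `n` all of whose suffixes are at least the prefix of `d` of the
same length. -/
def num (d : ℕ → ℕ) (n : ℕ) : ℤ := (numCum d n).1

/-- The number of those words of length `n` counted by `num d n` which are smaller than the prefix
of `x`, for a word `x` all of whose tails are at least `d`. -/
def cum (d : ℕ → ℕ) (n : ℕ) (x : ℕ → ℕ) : ℤ := (numCum d n).2 x

/-- Words all of whose tails are at least `d`. -/
def Above (d : ℕ → ℕ) : Set (ℕ → ℕ) := {x | ∀ n, AltLE d (shift n x)}

section
variable {d : ℕ → ℕ}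

theorem num_zero : num d 0 = 1 := rfl

theorem cum_zero (x : ℕ → ℕ) : cum d 0 x = 0 := rfl

theorem num_succ (n : ℕ) : num d (n + 1) = d 0 * num d n + cum d n (shift 1 d) + 1 := rfl

theorem cum_succ (n : ℕ) (x : ℕ → ℕ) :
    cum d (n + 1) x = num d (n + 1) - 1 - x 0 * num d n - cum d n (shift 1 x) := by
  rw [num_succ]
  simp only [cum, num, numCum]
  ring

theorem Above.shift {x : ℕ → ℕ} (hx : x ∈ Above d) (m : ℕ) : shift m x ∈ Above d := by
  intro n
  rw [shift_shift]
  exact hx _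

/-- The recursion classifies words by their first letter. A smaller first letter makes a word larger
and leaves the tail free; an equal first letter reverses the comparison of tails. -/
theorem cum_bounds (hd : IsAltLyndon d) (n : ℕ) :
    (∀ x ∈ Above d, 0 ≤ cum d n x ∧ cum d n x ≤ num d n - 1) ∧ cum d n d = 0 ∧
      ∀ x ∈ Above d, ∀ y ∈ Above d, AltLE x y → cum d n x ≤ cum d n y := by
  induction n with
  | zero => simp [num_zero, cum_zero]
  | succ n ih =>
    obtain ⟨ih1, ih2, ih3⟩ := ih
    have hN : 1 ≤ num d n := by have := (ih1 d hd).2; rw [ih2] at this; linarith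
    have hself : cum d (n + 1) d = 0 := by rw [cum_succ, num_succ]; ring
    have hmono : ∀ x ∈ Above d, ∀ y ∈ Above d, AltLE x y → cum d (n + 1) x ≤ cum d (n + 1) y := by
      intro x hx y hy hxy
      rw [cum_succ, cum_succ]
      have hx1 := ih1 _ (Above.shift hx 1)
      have hy1 := ih1 _ (Above.shift hy 1)
      rcases altLE_iff.1 hxy with h | ⟨h, h'⟩
      · have h2 : (y 0 : ℤ) + 1 ≤ x 0 := by exact_mod_cast h
        nlinarith
      · have := ih3 _ (Above.shift hy 1) _ (Above.shift hx 1) h'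
        rw [h]
        linarith
    refine ⟨fun x hx => ⟨?_, ?_⟩, hself, hmono⟩
    · rw [← hself]
      exact hmono d hd x hx (hx 0)
    · rw [cum_succ]
      have := (ih1 _ (Above.shift hx 1)).1
      have : (0 : ℤ) ≤ x 0 * num d n := by positivity
      linarith

theorem one_le_num (hd : IsAltLyndon d) (n : ℕ) : 1 ≤ num d n := by
  have h := cum_bounds hd n
  have := (h.1 d hd).2
  rw [h.2.1] at this
  linarith

/-- The rank `cum d n` determines the prefix of length `n`, so `num d n` bounds from above the
number of prefixes that occur in `Above d`. -/
theorem agree_of_cum_eq (hd : IsAltLyndon d) {n : ℕ} {x y : ℕ → ℕ} (hx : x ∈ Above d)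
    (hy : y ∈ Above d) (h : cum d n x = cum d n y) : ∀ i < n, x i = y i := by
  induction n generalizing x y with
  | zero => intro i hi; omega
  | succ n ih =>
    rw [cum_succ, cum_succ] at h
    have hx1 := (cum_bounds hd n).1 _ (Above.shift hx 1)
    have hy1 := (cum_bounds hd n).1 _ (Above.shift hy 1)
    have hN := one_le_num hd n
    have h0 : (x 0 : ℤ) = y 0 := by
      rcases lt_trichotomy (x 0 : ℤ) (y 0) with hlt | heq | hlt
      · have : (x 0 : ℤ) + 1 ≤ y 0 := hlt
        nlinarith
      · exact heq
      · have : (y 0 : ℤ) + 1 ≤ x 0 := hlt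
        nlinarith
    have h1 := ih (Above.shift hx 1) (Above.shift hy 1) (by rw [h0] at h; linarith)
    intro i hi
    cases i with
    | zero => exact_mod_cast h0
    | succ i => exact h1 i (by omega)

/-- Words of length `m + n` in an order interval are at most the prefixes of length `m` in it times
all `num d n` continuations. Intervals with both ends free are needed because passing to tails turns
lower bounds into upper ones. -/
theorem cum_add_le (hd : IsAltLyndon d) (m n : ℕ) :
    (∀ x ∈ Above d, num d (m + n) - cum d (m + n) x ≤ (num d m - cum d m x) * num d n) ∧
    ∀ x ∈ Above d, ∀ y ∈ Above d, AltLE x y →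
      cum d (m + n) y + 1 - cum d (m + n) x ≤ (cum d m y + 1 - cum d m x) * num d n := by
  induction m with
  | zero =>
    simp only [zero_add, num_zero, cum_zero]
    refine ⟨fun x hx => ?_, fun x hx y hy _ => ?_⟩
    · linarith [((cum_bounds hd n).1 x hx).1]
    · linarith [((cum_bounds hd n).1 x hx).1, ((cum_bounds hd n).1 y hy).2]
  | succ m ih =>
    obtain ⟨ih1, ih2⟩ := ih
    have hN : num d (m + n) ≤ num d m * num d n := by
      have := ih1 d hd
      rwa [(cum_bounds hd _).2.1, (cum_bounds hd _).2.1, sub_zero, sub_zero] at this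
    have hlow : ∀ x ∈ Above d, cum d (m + n) x + 1 ≤ (cum d m x + 1) * num d n := by
      intro x hx
      have := ih2 d hd x hx (hx 0)
      rwa [(cum_bounds hd _).2.1, (cum_bounds hd _).2.1, sub_zero, sub_zero] at this
    rw [show m + 1 + n = (m + n) + 1 by ring]
    refine ⟨fun x hx => ?_, fun x hx y hy hxy => ?_⟩
    · rw [cum_succ, cum_succ]
      have h1 := hlow _ (Above.shift hx 1)
      have h2 : (x 0 : ℤ) * num d (m + n) ≤ x 0 * (num d m * num d n) := by gcongr
      linarith
    · rw [cum_succ, cum_succ, cum_succ, cum_succ]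
      rcases altLE_iff.1 hxy with h | ⟨h, h'⟩
      · have h1 := hlow _ (Above.shift hx 1)
        have h2 := ih1 _ (Above.shift hy 1)
        have h3 : (0 : ℤ) ≤ x 0 - y 0 - 1 := by
          have : (y 0 : ℤ) + 1 ≤ x 0 := by exact_mod_cast h
          linarith
        have h4 := mul_le_mul_of_nonneg_left hN h3
        linarith
      · have h1 := ih2 _ (Above.shift hy 1) _ (Above.shift hx 1) h'
        rw [h]
        linarith

theorem num_add_le (hd : IsAltLyndon d) (m n : ℕ) : num d (m + n) ≤ num d m * num d n := by
  have := (cum_add_le hd m n).1 d hd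
  rwa [(cum_bounds hd _).2.1, (cum_bounds hd _).2.1, sub_zero, sub_zero] at this

/-- All words `φ^m(x)` with `x` binary have tails above `d`, and the first `q` letters of `x` are
determined by `3^m q` letters of the image. -/
theorem two_pow_le_num (hd : IsAltLyndon d) (hlt : AltLT d phiInf) :
    ∃ m, ∀ q, (2 : ℤ) ^ q ≤ num d (3 ^ m * q) := by
  classical
  obtain ⟨m, hm⟩ := exists_iterate_phiW_lt hlt
  refine ⟨m, fun q => ?_⟩
  set n := 3 ^ m * q
  let f : (Fin q → Bool) → (ℕ → ℕ) := fun w i => if h : i < q then (w ⟨i, h⟩).toNat else 0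
  have hf : ∀ w, Binary (f w) := by
    intro w i
    simp only [f]
    split_ifs
    · exact Bool.toNat_le _
    · omega
  have hmem : ∀ w, phiW^[m] (f w) ∈ Above d := fun w k => (hm _ (hf w) k).le
  have hcard := Finset.card_le_card_of_injOn (s := (Finset.univ : Finset (Fin q → Bool)))
    (t := Finset.Ico (0 : ℤ) (num d n)) (fun w => cum d n (phiW^[m] (f w))) ?_ ?_
  · simp only [Finset.card_univ, Fintype.card_fun, Fintype.card_bool, Fintype.card_fin,
      Int.card_Ico, sub_zero] at hcard
    have h1 := one_le_num hd n
    have : ((2 ^ q : ℕ) : ℤ) ≤ ((num d n).toNat : ℤ) := by exact_mod_cast hcard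
    rw [Int.toNat_of_nonneg (by linarith)] at this
    exact_mod_cast this
  · intro w _
    have := (cum_bounds hd n).1 _ (hmem w)
    simp only [Finset.coe_Ico, Set.mem_Ico]
    exact ⟨this.1, by linarith⟩
  · intro w _ w' _ hww
    have h1 := agree_of_cum_eq hd (hmem w) (hmem w') hww
    have h2 := agree_of_iterate_phiW_agree (hf w) (hf w') m h1
    funext i
    have := h2 i i.2
    simp only [f, i.2, dite_true] at this
    revert this
    cases w i <;> cases w' i <;> simp

/-! ### The growth rate is a base in which the value vanishes -/

/-- Fekete's lemma for `log (num d n)`: the limit is also a lower bound, whence `l ^ n ≤ num d n`.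
It is positive by the bound `2^q` along multiples of `3^m`. -/
theorem exists_growth_rate (hd : IsAltLyndon d) (hlt : AltLT d phiInf) :
    ∃ l : ℝ, 1 < l ∧ (∀ n, l ^ n ≤ num d n) ∧
      ∀ s, l < s → Summable fun n : ℕ => (num d n : ℝ) * (1 / s) ^ n := by
  have hN : ∀ n, (1 : ℝ) ≤ num d n := fun n => by exact_mod_cast one_le_num hd n
  have hN0 : ∀ n, (0 : ℝ) < num d n := fun n => one_pos.trans_le (hN n)
  have hsub : Subadditive fun n => Real.log (num d n) := by
    intro m n
    rw [← Real.log_mul (hN0 m).ne' (hN0 n).ne']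
    exact Real.log_le_log (hN0 _) (by exact_mod_cast num_add_le hd m n)
  have hbdd : BddBelow (Set.range fun n : ℕ => Real.log (num d n) / n) := by
    refine ⟨0, ?_⟩
    rintro _ ⟨n, rfl⟩
    exact div_nonneg (Real.log_nonneg (hN n)) (Nat.cast_nonneg n)
  have hlim := hsub.tendsto_lim hbdd
  refine ⟨Real.exp hsub.lim, ?_, ?_, ?_⟩
  · obtain ⟨m, hm⟩ := two_pow_le_num hd hlt
    rw [Real.one_lt_exp_iff]
    have h3 : (0 : ℝ) < 3 ^ m := by positivity
    refine lt_of_lt_of_le (div_pos (Real.log_pos one_lt_two) h3) (ge_of_tendsto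
      (hlim.comp (Filter.tendsto_id.const_mul_atTop' (by positivity : 0 < 3 ^ m)))
      (Filter.eventually_atTop.2 ⟨1, fun q hq => ?_⟩))
    simp only [Function.comp, id]
    have hq0 : (0 : ℝ) < q := by exact_mod_cast hq
    have h1 : (2 : ℝ) ^ q ≤ num d (3 ^ m * q) := by exact_mod_cast hm q
    have h2 := Real.log_le_log (by positivity) h1
    rw [Real.log_pow] at h2
    push_cast
    rw [div_le_div_iff₀ h3 (by positivity)]
    calc Real.log 2 * (3 ^ m * q) = q * Real.log 2 * 3 ^ m := by ring
      _ ≤ _ := by gcongr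
  · intro n
    rcases Nat.eq_zero_or_pos n with rfl | hn
    · simp [num_zero]
    · have h := hsub.lim_le_div hbdd hn.ne'
      have hn0 : (0 : ℝ) < n := by exact_mod_cast hn
      rw [le_div_iff₀ hn0] at h
      rw [← Real.exp_nat_mul, ← Real.le_log_iff_exp_le (hN0 n)]
      linarith
  · intro s hs
    have hs0 : 0 < s := (Real.exp_pos _).trans hs
    obtain ⟨r, hr1, hr2⟩ := exists_between hs
    have hr0 : 0 < r := (Real.exp_pos _).trans hr1
    have hev : ∀ᶠ n : ℕ in Filter.atTop, (num d n : ℝ) ≤ r ^ n := by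
      have hlr : hsub.lim < Real.log r := by rwa [Real.lt_log_iff_exp_lt hr0]
      filter_upwards [hlim.eventually_lt_const hlr, Filter.eventually_gt_atTop 0] with n hn hn0
      have hn0' : (0 : ℝ) < n := by exact_mod_cast hn0
      rw [div_lt_iff₀ hn0'] at hn
      rw [← Real.log_le_log_iff (hN0 n) (by positivity), Real.log_pow]
      linarith
    refine Summable.of_norm_bounded_eventually_nat (g := fun n => (r / s) ^ n)
      (summable_geometric_of_lt_one (by positivity) (by rwa [div_lt_one hs0])) ?_
    filter_upwards [hev] with n hn
    rw [Real.norm_of_nonneg (mul_nonneg (hN0 n).le (by positivity)), div_eq_mul_one_div r s, mul_pow]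
    gcongr

/-- The generating functions of the ranks of successive tails satisfy the orbit relation up to a
constant after division by that of `num`; uniqueness of bounded solutions identifies them with
values. -/
theorem val_eq_of_summable (hd : IsAltLyndon d) {s : ℝ} (hs : 1 < s)
    (hsum : Summable fun n : ℕ => (num d n : ℝ) * (1 / s) ^ n) {x : ℕ → ℕ} (hx : x ∈ Above d)
    (hxb : Bdd x) :
    val s x = ((∑' n : ℕ, (cum d n x : ℝ) * (1 / s) ^ n) + s ^ 2 / (s ^ 2 - 1)) /
      ∑' n : ℕ, (num d n : ℝ) * (1 / s) ^ n ∧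
    Summable fun n : ℕ => (cum d n x : ℝ) * (1 / s) ^ n := by
  have hs0 : 0 < s := by linarith
  have hC : ∀ i n, (0 : ℝ) ≤ cum d n (shift i x) ∧ (cum d n (shift i x) : ℝ) ≤ num d n := by
    intro i n
    have := (cum_bounds hd n).1 _ (Above.shift hx i)
    refine ⟨by exact_mod_cast this.1, ?_⟩
    have h2 : cum d n (shift i x) ≤ num d n := by linarith
    exact_mod_cast h2
  have hCsum : ∀ i, Summable fun n : ℕ => (cum d n (shift i x) : ℝ) * (1 / s) ^ n := by
    intro i
    refine Summable.of_nonneg_of_le (fun n => mul_nonneg (hC i n).1 (by positivity)) (fun n => ?_) hsum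
    exact mul_le_mul_of_nonneg_right (hC i n).2 (by positivity)
  set Z := ∑' n : ℕ, (num d n : ℝ) * (1 / s) ^ n with hZ
  set H : ℕ → ℝ := fun i => ∑' n : ℕ, (cum d n (shift i x) : ℝ) * (1 / s) ^ n with hH
  have hgeo : Summable fun n : ℕ => (1 / s) ^ n :=
    summable_geometric_of_lt_one (by positivity) (by rw [div_lt_one] <;> linarith)
  have hgeo' : ∑' n : ℕ, (1 / s) ^ n = s / (s - 1) := by
    rw [tsum_geometric_of_lt_one (by positivity) (by rw [div_lt_one] <;> linarith)]
    rw [show 1 - 1 / s = (s - 1) / s by field_simp, inv_div]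
  have hZ1 : 1 ≤ Z := by
    have hpos : ∀ n, (0 : ℝ) ≤ num d n := fun n => by
      have := one_le_num hd n
      exact_mod_cast (by linarith : (0 : ℤ) ≤ num d n)
    calc (1 : ℝ) = (num d 0 : ℝ) * (1 / s) ^ 0 := by simp [num_zero]
      _ ≤ Z := hsum.le_tsum 0 fun n _ => mul_nonneg (hpos n) (by positivity)
  have hrec : ∀ i, H i = Z - s / (s - 1) - x i * Z / s - H (i + 1) / s := by
    intro i
    have e : ∀ n : ℕ, (cum d (n + 1) (shift i x) : ℝ) * (1 / s) ^ (n + 1) =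
        (num d (n + 1) : ℝ) * (1 / s) ^ (n + 1) - (1 / s) ^ (n + 1)
        - (x i / s) * ((num d n : ℝ) * (1 / s) ^ n)
        - (1 / s) * ((cum d n (shift (i + 1) x) : ℝ) * (1 / s) ^ n) := by
      intro n
      rw [cum_succ, shift_shift, add_comm 1 i, show shift i x 0 = x i by simp [shift]]
      push_cast
      ring
    have hs1 : Summable fun n : ℕ => (num d (n + 1) : ℝ) * (1 / s) ^ (n + 1) :=
      (summable_nat_add_iff 1).2 hsum
    have hs2 : Summable fun n : ℕ => (1 / s) ^ (n + 1) := (summable_nat_add_iff 1).2 hgeo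
    have hH0 : H i = ∑' n : ℕ, (cum d (n + 1) (shift i x) : ℝ) * (1 / s) ^ (n + 1) := by
      simp only [hH]
      rw [(hCsum i).tsum_eq_zero_add]
      simp [cum_zero]
    have hZ0 : Z = 1 + ∑' n : ℕ, (num d (n + 1) : ℝ) * (1 / s) ^ (n + 1) := by
      rw [hZ, hsum.tsum_eq_zero_add]
      simp [num_zero]
    have hg0 : s / (s - 1) = 1 + ∑' n : ℕ, (1 / s) ^ (n + 1) := by
      rw [← hgeo', hgeo.tsum_eq_zero_add]
      simp
    rw [hH0]
    simp only [e]
    rw [Summable.tsum_sub ((hs1.sub hs2).sub (hsum.mul_left _)) ((hCsum (i + 1)).mul_left _),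
      Summable.tsum_sub (hs1.sub hs2) (hsum.mul_left _), Summable.tsum_sub hs1 hs2, tsum_mul_left,
      tsum_mul_left, ← hZ]
    have : H (i + 1) = ∑' n : ℕ, (cum d n (shift (i + 1) x) : ℝ) * (1 / s) ^ n := rfl
    rw [← this, hg0]
    rw [show ∑' n : ℕ, (num d (n + 1) : ℝ) * (1 / s) ^ (n + 1) = Z - 1 by linarith]
    ring
  have hHb : ∀ i, 0 ≤ H i ∧ H i ≤ Z := fun i =>
    ⟨tsum_nonneg fun n => mul_nonneg (hC i n).1 (by positivity),
      (hCsum i).tsum_le_tsum (fun n => mul_le_mul_of_nonneg_right (hC i n).2 (by positivity)) hsum⟩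
  have hk : 0 < s ^ 2 / (s ^ 2 - 1) := div_pos (by positivity) (by nlinarith)
  refine ⟨?_, hCsum 0⟩
  -- The constant `κ = s²/(s² - 1)` solves `κ(1 + 1/s) = s/(s - 1)`, which absorbs the inhomogeneous
  -- term of `hrec`.
  refine val_shift_eq hs hxb (t := fun i => (H i + s ^ 2 / (s ^ 2 - 1)) / Z)
    (K := 1 + s ^ 2 / (s ^ 2 - 1)) ?_ ?_ 0
  · intro i
    obtain ⟨h1, h2⟩ := hHb i
    rw [abs_of_nonneg (by positivity), div_le_iff₀ (by linarith)]
    nlinarith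
  · intro i
    rw [hrec i]
    have h1 : s - 1 ≠ 0 := by linarith
    have h2 : s + 1 ≠ 0 := by linarith
    have h3 : Z ≠ 0 := by linarith
    rw [show s ^ 2 - 1 = (s - 1) * (s + 1) by ring]
    field_simp
    ring

theorem tendsto_val {l : ℝ} (hl : 1 < l) {x : ℕ → ℕ} (hx : Bdd x) :
    Filter.Tendsto (fun s => val s x) (nhdsWithin l (Set.Ioi l)) (nhds (val l x)) := by
  obtain ⟨M, hM⟩ := hx
  have hcont : ContinuousOn (fun s => val s x) (Set.Ici l) := by
    refine continuousOn_tsum (fun i => ?_) (summable_geom_bound hl (1 + (M : ℝ))) ?_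
    · have h0 : ∀ s ∈ Set.Ici l, s ≠ 0 := fun s hs => by
        have : l ≤ s := hs
        linarith
      exact ((continuousOn_const.div continuousOn_id h0).pow i).mul
        (continuousOn_const.sub (continuousOn_const.div continuousOn_id h0))
    · intro i s hs
      have hs' : l ≤ s := hs
      have hs0 : 0 < s := by linarith
      refine (abs_val_term_le (by linarith) hM i).trans ?_
      gcongr
  exact (hcont l Set.self_mem_Ici).mono_left (nhdsWithin_mono _ Set.Ioi_subset_Ici_self)

/-- From `l ^ n ≤ num d n` the denominator is at least `1/(1 - l/s)`, so the correction term
vanishes as `s` decreases to `l`. What remains is a quotient in `[0, 1]`, equal to `0` for `d`,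
whose ranks are all `0`. -/
theorem exists_base (hd : IsAltLyndon d) (hlt : AltLT d phiInf) :
    ∃ β : ℝ, 1 < β ∧ val β d = 0 ∧ ∀ n, 0 ≤ val β (shift n d) ∧ val β (shift n d) ≤ 1 := by
  obtain ⟨l, hl, hpow, hsum⟩ := exists_growth_rate hd hlt
  have hbound : ∀ s, l < s → ∀ x ∈ Above d, Bdd x →
      0 ≤ val s x ∧ val s x ≤ 1 + s ^ 2 / (s ^ 2 - 1) * (1 - l / s) ∧
      (x = d → val s x ≤ s ^ 2 / (s ^ 2 - 1) * (1 - l / s)) := by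
    intro s hs x hx hxb
    have hs1 : 1 < s := hl.trans hs
    have hs0 : 0 < s := by linarith
    have hk : 0 < s ^ 2 / (s ^ 2 - 1) := div_pos (by positivity) (by nlinarith)
    obtain ⟨hv, hC⟩ := val_eq_of_summable hd hs1 (hsum s hs) hx hxb
    have hZ : (1 - l / s)⁻¹ ≤ ∑' n : ℕ, (num d n : ℝ) * (1 / s) ^ n := by
      have hls : l / s < 1 := by rwa [div_lt_one hs0]
      have hls0 : 0 ≤ l / s := by positivity
      rw [← tsum_geometric_of_lt_one hls0 hls]
      refine (summable_geometric_of_lt_one hls0 hls).tsum_le_tsum (fun n => ?_) (hsum s hs)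
      rw [div_eq_mul_one_div l s, mul_pow]
      gcongr
      exact hpow n
    have hgap : 0 < 1 - l / s := by rw [sub_pos, div_lt_one hs0]; exact hs
    set Z := ∑' n : ℕ, (num d n : ℝ) * (1 / s) ^ n
    have hZ0 : 0 < Z := (inv_pos.2 hgap).trans_le hZ
    have hkZ : s ^ 2 / (s ^ 2 - 1) / Z ≤ s ^ 2 / (s ^ 2 - 1) * (1 - l / s) := by
      rw [div_eq_mul_inv _ Z]
      gcongr
      exact inv_le_of_inv_le₀ hgap hZ
    have hH0 : 0 ≤ ∑' n : ℕ, (cum d n x : ℝ) * (1 / s) ^ n :=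
      tsum_nonneg fun n => mul_nonneg (by exact_mod_cast ((cum_bounds hd n).1 x hx).1) (by positivity)
    have hHZ : ∑' n : ℕ, (cum d n x : ℝ) * (1 / s) ^ n ≤ Z := by
      refine hC.tsum_le_tsum (fun n => ?_) (hsum s hs)
      have : cum d n x ≤ num d n := by linarith [((cum_bounds hd n).1 x hx).2]
      gcongr
    rw [hv, add_div]
    refine ⟨by positivity, ?_, ?_⟩
    · exact add_le_add ((div_le_one hZ0).2 hHZ) hkZ
    · rintro rfl
      have : ∑' n : ℕ, (cum x n x : ℝ) * (1 / s) ^ n = 0 := by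
        simp [(cum_bounds hd _).2.1]
      rw [this, zero_div, zero_add]
      exact hkZ
  have hlim0 : Filter.Tendsto (fun s : ℝ => s ^ 2 / (s ^ 2 - 1) * (1 - l / s))
      (nhdsWithin l (Set.Ioi l)) (nhds 0) := by
    have h0 : l ^ 2 / (l ^ 2 - 1) * (1 - l / l) = 0 := by
      rw [div_self (by linarith)]; ring
    rw [← h0]
    refine Filter.Tendsto.mono_left (ContinuousAt.tendsto ?_) nhdsWithin_le_nhds
    have h1 : l ^ 2 - 1 ≠ 0 := by nlinarith
    have h2 : l ≠ 0 := by linarith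
    fun_prop (disch := assumption)
  have hev : ∀ᶠ s in nhdsWithin l (Set.Ioi l), l < s := eventually_mem_nhdsWithin
  have hmem : ∀ n, shift n d ∈ Above d := fun n => Above.shift (x := d) hd n
  refine ⟨l, hl, le_antisymm ?_ ?_, fun n => ⟨?_, ?_⟩⟩
  · exact le_of_tendsto_of_tendsto (tendsto_val hl hd.bdd) hlim0
      (hev.mono fun s hs => (hbound s hs d hd hd.bdd).2.2 rfl)
  · exact ge_of_tendsto (tendsto_val hl hd.bdd) (hev.mono fun s hs => (hbound s hs d hd hd.bdd).1)
  · exact ge_of_tendsto (tendsto_val hl (hd.bdd.shift n))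
      (hev.mono fun s hs => (hbound s hs _ (hmem n) (hd.bdd.shift n)).1)
  · have h := le_of_tendsto_of_tendsto (tendsto_val hl (hd.bdd.shift n)) (hlim0.const_add 1)
      (hev.mono fun s hs => (hbound s hs _ (hmem n) (hd.bdd.shift n)).2.1)
    simpa using h

end

/-! ### Sufficiency of the conditions -/

theorem val_shift_succ {β : ℝ} (hβ : 1 < β) {x : ℕ → ℕ} (hx : Bdd x) (n : ℕ) :
    (x n : ℝ) + val β (shift (n + 1) x) = β * (1 - val β (shift n x)) := by
  have h := val_rec hβ (hx.shift n)
  rw [shift_shift, add_comm 1 n, show shift n x 0 = x n by simp [shift]] at h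
  rw [h]
  have : β ≠ 0 := by linarith
  field_simp
  ring

theorem val_shift_eq_of_agree {β : ℝ} (hβ : 1 < β) {x a : ℕ → ℕ} (hx : Bdd x) (ha : Bdd a)
    (h0 : val β x = val β a) {n : ℕ} (h : ∀ i < n, x i = a i) :
    val β (shift n x) = val β (shift n a) := by
  induction n with
  | zero => exact h0
  | succ n ih =>
    have ih := ih fun i hi => h i (by omega)
    have h1 := val_shift_succ hβ hx n
    have h2 := val_shift_succ hβ ha n
    rw [ih, h n (by omega)] at h1
    linarith

/-- Where a word with tails in the closed interval leaves the expansion of the left end point, the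
orbit of the end point returns to the left end point. -/
theorem first_difference {β : ℝ} (hβ : 1 < β) {x a : ℕ → ℕ} (hx : Bdd x) (ha : Bdd a)
    (h0 : val β x = val β a) (hx1 : ∀ i, 0 ≤ val β (shift i x) ∧ val β (shift i x) ≤ 1)
    (ha1 : ∀ i, 0 ≤ val β (shift i a) ∧ val β (shift i a) < 1) {n : ℕ}
    (h : ∀ i < n, x i = a i) (hn : x n ≠ a n) :
    x n + 1 = a n ∧ val β (shift (n + 1) a) = 0 ∧ val β (shift (n + 1) x) = 1 := by
  have h1 := val_shift_succ hβ hx n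
  have h2 := val_shift_succ hβ ha n
  rw [val_shift_eq_of_agree hβ hx ha h0 h] at h1
  have hxn := hx1 (n + 1)
  have han := ha1 (n + 1)
  have e : (a n : ℝ) < x n + 2 ∧ (x n : ℝ) ≤ a n + val β (shift (n + 1) a) := by
    constructor <;> linarith
  have e1 : a n < x n + 2 := by exact_mod_cast e.1
  have e2 : x n < a n + 1 := by exact_mod_cast (by linarith : (x n : ℝ) < a n + 1)
  have e3 : x n + 1 = a n := by omega
  have e4 : (x n : ℝ) + 1 = a n := by exact_mod_cast e3
  exact ⟨e3, by linarith, by linarith⟩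

theorem isNegExpansion_or_mem_lyn {β : ℝ} (hβ : 1 < β) {d : ℕ → ℕ} (hd : IsAltLyndon d)
    (h0 : val β d = 0) (h1 : ∀ n, 0 ≤ val β (shift n d) ∧ val β (shift n d) ≤ 1) :
    IsNegExpansion β (-β / (β + 1)) d ∨ d ∈ Lyn := by
  classical
  obtain ⟨a, ha⟩ := exists_isNegExpansion hβ
  have halyn := lyndon_of_isNegExpansion hβ ha
  obtain ⟨hab, ha0, ha1⟩ := (isNegExpansion_iff hβ).1 ha
  by_cases hda : d = a
  · exact Or.inl (hda ▸ ha)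
  right
  have hdiff : ∀ x y : ℕ → ℕ, x ≠ y → ∃ n, (∀ i < n, x i = y i) ∧ x n ≠ y n := by
    intro x y hxy
    have hex : ∃ n, x n ≠ y n := by
      by_contra! hcon
      exact hxy (funext hcon)
    exact ⟨Nat.find hex, fun i hi => by simpa using Nat.find_min hex hi, Nat.find_spec hex⟩
  obtain ⟨n, hn, hne⟩ := hdiff d a hda
  have hex : ∃ k, 0 < k ∧ val β (shift k a) = 0 :=
    ⟨n + 1, n.succ_pos, (first_difference hβ hd.bdd hab (h0.trans ha0.symm) h1 ha1 hn hne).2.1⟩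
  obtain ⟨hk, hka⟩ := Nat.find_spec hex
  have hkmin : ∀ m, 0 < m → val β (shift m a) = 0 → Nat.find hex ≤ m := fun m hm hma =>
    Nat.find_min' hex ⟨hm, hma⟩
  set k := Nat.find hex
  -- Two different words of value `0` would separate with one of them reaching the value `1`, which
  -- tails of `a` never do.
  have hper : Function.Periodic a k := by
    have : shift k a = a := by
      by_contra hcon
      obtain ⟨n, hn, hne⟩ := hdiff _ _ hcon
      have := (first_difference hβ (hab.shift k) hab (hka.trans ha0.symm)
        (fun i => by rw [shift_shift]; exact ⟨(ha1 _).1, (ha1 _).2.le⟩) ha1 hn hne).2.2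
      rw [shift_shift] at this
      linarith [(ha1 (n + 1 + k)).2]
    exact fun i => congrFun this i
  have hmin : HasMinPeriod a k := by
    refine ⟨⟨hk, hper⟩, ?_⟩
    rintro m ⟨hm, hmper⟩
    refine hkmin m hm ?_
    have : shift m a = a := funext hmper
    rw [this, ha0]
  have hlast : a (k - 1) ≠ 0 := by
    intro h
    have := val_ne_zero_of_preceded hβ hab ha1 h
    rw [Nat.sub_add_cancel hk] at this
    exact this hka
  have hS : IsCode (oddBlock a k) (evenBlock a k) {x | (∃ n, x = shift n d) ∧ val β x = 0} := by
    rintro x ⟨⟨n, hxn⟩, hx0⟩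
    have hxb : Bdd x := hxn ▸ hd.bdd.shift n
    have hx1 : ∀ i, 0 ≤ val β (shift i x) ∧ val β (shift i x) ≤ 1 := fun i => by
      rw [hxn, shift_shift]; exact h1 _
    simp only [eq_concat_pre_or_lowered]
    by_cases hag : ∀ i < k, x i = a i
    · refine ⟨shift k x, ⟨⟨k + n, by rw [hxn, shift_shift]⟩, ?_⟩, Or.inl ?_⟩
      · rw [val_shift_eq_of_agree hβ hxb hab (hx0.trans ha0.symm) hag, hka]
      · have : pre a k = pre x k := by
          simp only [pre]
          exact List.map_congr_left fun i hi => (hag i (List.mem_range.1 hi)).symm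
        rw [this, concat_pre_shift]
    · obtain ⟨i, hi, hne⟩ := hdiff x a (fun h => hag fun i _ => congrFun h i)
      have hik : i < k := by
        by_contra! hcon
        exact hag fun j hj => hi j (by omega)
      obtain ⟨f1, f2, f3⟩ := first_difference hβ hxb hab (hx0.trans ha0.symm) hx1 ha1 hi hne
      have hik' := hkmin (i + 1) i.succ_pos f2
      -- A separation forces a return of `a` to value `0`, and the first return is at `k`. The tail
      -- of `x` then has value `1`, so its next letter is `0` and the value after it is `0`: this is
      -- the lowered block.
      obtain rfl : i = k - 1 := by omega
      rw [Nat.sub_add_cancel hk] at f3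
      have hrec := val_shift_succ hβ hxb k
      rw [f3] at hrec
      have hv := (hx1 (k + 1)).1
      have hxk : (0 : ℝ) ≤ x k := Nat.cast_nonneg _
      have hxk0 : x k = 0 := by exact_mod_cast (by linarith : (x k : ℝ) = 0)
      refine ⟨shift (k + 1) x, ⟨⟨k + 1 + n, by rw [hxn, shift_shift]⟩, by linarith⟩, Or.inr ?_⟩
      have : lowered a k = pre x (k + 1) := by
        have hp : pre a (k - 1) = pre x (k - 1) := by
          simp only [pre]
          exact List.map_congr_left fun i hj => (hi i (List.mem_range.1 hj)).symm
        rw [pre_succ, pre_eq_append hk, lowered, hp, hxk0, ← f1]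
        simp
      rw [this, concat_pre_shift]
  have hdS : d ∈ {x | (∃ n, x = shift n d) ∧ val β x = 0} := ⟨⟨0, rfl⟩, h0⟩
  refine ⟨hd, a, k, halyn, hmin, hlast, hda, hS.minWord_le hk hper hlast hdS,
    hS.le_maxWord hk hper hlast hdS, ?_⟩
  -- Otherwise `phiInf`, being a Lyndon word, would lie with all its tails in the range of the code
  -- and have value `0`, hence be smaller than itself.
  by_contra hcon
  rw [not_altLT] at hcon
  have hlow := ((minWord_le_self hk hper hlast).trans_lt
    (lt_phiInf_of_val_eq_zero hβ halyn ha0)).le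
  have := (isCode_of_between hk hper).val_eq_zero hβ hk hper hlast hab ha0 phiInf
    ⟨hcon, fun n => hlow.trans (phiInf_lyndon n)⟩
  exact altLT_irrefl _ (lt_phiInf_of_val_eq_zero hβ phiInf_lyndon this)

end NegBeta

theorem theorem3 (d : ℕ → ℕ) :
    (∃ β : ℝ, 1 < β ∧ NegBeta.IsNegExpansion β (-β / (β + 1)) d) ↔
      ((∀ n : ℕ, NegBeta.AltLE d (NegBeta.shift n d) ∧
          NegBeta.AltLT (NegBeta.shift n d) (NegBeta.concat [0] (NegBeta.dStar d))) ∧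
        d ∉ NegBeta.Lyn ∧
        NegBeta.AltLT d NegBeta.phiInf) := by
  constructor
  · rintro ⟨β, hβ, h⟩
    have hlyn := NegBeta.lyndon_of_isNegExpansion hβ h
    exact ⟨fun n => ⟨hlyn n, NegBeta.shift_lt_of_isNegExpansion hβ h n⟩,
      NegBeta.not_mem_lyn_of_isNegExpansion hβ h,
      NegBeta.lt_phiInf_of_val_eq_zero hβ hlyn ((NegBeta.isNegExpansion_iff hβ).1 h).2.1⟩
  · rintro ⟨ha, hb, hc⟩
    have hlyn : NegBeta.IsAltLyndon d := fun n => (ha n).1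
    obtain ⟨β, hβ, h0, h1⟩ := NegBeta.exists_base hlyn hc
    exact ⟨β, hβ, (NegBeta.isNegExpansion_or_mem_lyn hβ hlyn h0 h1).resolve_right hb⟩
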